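/- **Lemma 4.1 (energy estimate).** For every $s>0$ there is a constant $C_0>0$, depending only on $s$, such that the following holds. Let $0<\alpha\le 1$, $T>0$, and let $u\in C([0,T];H^\infty(\mathbb{R}^2))$, where $H^\infty(\mathbb{R}^2)=\bigcap_{r\in\mathbb{R}}H^r(\mathbb{R}^2)$, be a real-valued solution on $[0,T]$ of $$u_t+D_x^\alpha u_x+\mathcal{H}u_{yy}+u\,u_x=0,\qquad u(0)=u_0,$$ where $D_x^\alpha$ and the Hilbert transform $\mathcal{H}$ in $x$ are the Fourier multipliers $(D_x^\alpha f)^\wedge(\xi,\eta)=|\xi|^\alpha\hat f(\xi,\eta)$ and $(\mathcal{H}f)^\wedge(\xi,\eta)=-i\,\mathrm{sgn}(\xi)\hat f(\xi,\eta)$; the equation holds in $L^2(\mathbb{R}^2)$ for each $t\in[0,T]$, with $u_t$ the derivative of the $L^2$-valued function $u$ (one-sided at the endpoints). Then $$\|u\|_{L^\infty_T H^s}^2\le \|u_0\|_{H^s}^2+C_0\,\|\nabla u\|_{L^1_T L^\infty_{xy}}\,\|u\|_{L^\infty_T H^s}^2 ,$$ where $\|f\|_{H^s}=\|(1-\Delta)^{s/2}f\|_{L^2}$,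 $\|u\|_{L^\infty_TH^s}=\operatorname{ess\,sup}_{t\in[0,T]}\|u(t)\|_{H^s}$ and $\|\nabla u\|_{L^1_TL^\infty_{xy}}=\int_0^T\big(\|\partial_xu(t)\|_{L^\infty(\mathbb{R}^2)}+\|\partial_yu(t)\|_{L^\infty(\mathbb{R}^2)}\big)\,dt$. -/

import Mathlib

namespace FracBO

open MeasureTheory Filter Topology SchwartzMap FourierTransform
open scoped ENNReal LineDeriv

noncomputable section

/-- The plane `ℝ²`, with coordinates `x = p 0`, `y = p 1` (and `ξ = p 0`, `η = p 1` on the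
Fourier side). -/
abbrev Plane : Type := EuclideanSpace ℝ (Fin 2)

/-- Complex-valued `L²(ℝ²)`. -/
abbrev L2 : Type := Lp ℂ 2 (volume : Measure Plane)

/-- The operator on `L²(ℝ²)` with Fourier symbol `m`: `(m(D) f)^ (ζ) = m (2 π ζ) f^ (ζ)`, on its
natural domain `{f | m (2 π ·) f^ ∈ L²}` (and `0` outside of this domain).

Mathlib's Fourier transform is `f^ (ζ) = ∫ exp (-2 π i z·ζ) f z dz`; the argument `2 π ζ` of the
symbol is the angular frequency `(ξ, η)`, for which `∂_x` has the symbol `i ξ`. -/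
def multiplier (m : Plane → ℂ) (f : L2) : L2 :=
  open Classical in
  if h : MemLp (fun ζ : Plane => m ((2 * Real.pi) • ζ) * (𝓕 f : L2) ζ) 2 volume then
    𝓕⁻ (h.toLp _)
  else 0

/-- The partial derivative `∂_x` (`j = 0`) or `∂_y` (`j = 1`) on `L²(ℝ²)`, with symbol `i ξ` or
`i η`. It is the distributional derivative, see `pderiv_eq_lineDeriv`. -/
def pderiv (j : Fin 2) (f : L2) : L2 :=
  multiplier (fun p => Complex.I * (p j : ℂ)) f

/-- `D_x^α`, with symbol `|ξ|^α`. -/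
def fracDx (α : ℝ) (f : L2) : L2 :=
  multiplier (fun p => ((|p 0| ^ α : ℝ) : ℂ)) f

/-- The Hilbert transform in the variable `x`, with symbol `-i sgn ξ`. -/
def hilbert (f : L2) : L2 :=
  multiplier (fun p => -Complex.I * (Real.sign (p 0) : ℂ)) f

/-- The norm of `H^s(ℝ²)`, `‖f‖_{H^s} = ‖(1 + ξ² + η²)^{s/2} f^‖_{L²} = ‖(1 - Δ)^{s/2} f‖_{L²}`
(`(ξ, η)` the angular frequency), with value `∞` if `f` is not in `H^s`. -/
def hsNorm (s : ℝ) (f : L2) : ℝ≥0∞ :=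
  eLpNorm (fun ζ : Plane =>
    (((1 + ‖(2 * Real.pi) • ζ‖ ^ 2) ^ (s / 2) : ℝ) : ℂ) * (𝓕 f : L2) ζ) 2 volume

/-- `f ∈ H^∞(ℝ²) = ⋂_s H^s(ℝ²)`. -/
def MemHInfty (f : L2) : Prop := ∀ s : ℝ, hsNorm s f < ∞

/-- `u ∈ C([0,T]; H^∞(ℝ²))`: for every `s`, the map `u` is continuous from `[0,T]` to `H^s`. -/
def ContinuousInHInfty (T : ℝ) (u : ℝ → L2) : Prop :=
  (∀ t ∈ Set.Icc 0 T, MemHInfty (u t)) ∧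
  ∀ s : ℝ, ∀ t₀ ∈ Set.Icc 0 T,
    Tendsto (fun t => hsNorm s (u t - u t₀)) (𝓝[Set.Icc 0 T] t₀) (𝓝 0)

/-- `u` is real-valued for all times in `[0,T]`. -/
def IsRealOn (T : ℝ) (u : ℝ → L2) : Prop :=
  ∀ t ∈ Set.Icc 0 T, ∀ᵐ p : Plane, (u t p).im = 0

/-- `u` solves `u_t + D_x^α u_x + 𝓗 u_yy + u u_x = 0` on `[0,T]` with `u(0) = u₀`. The time
derivative is that of an `L²(ℝ²)`-valued function (one-sided at `0` and `T`), and the equation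
holds in `L²(ℝ²)`, that is almost everywhere in the plane, at each time. -/
def IsSolution (α T : ℝ) (u₀ : L2) (u : ℝ → L2) : Prop :=
  u 0 = u₀ ∧
  ∀ t ∈ Set.Icc 0 T, ∃ v : L2, HasDerivWithinAt u v (Set.Icc 0 T) t ∧
    ∀ᵐ p : Plane,
      v p + fracDx α (pderiv 0 (u t)) p + hilbert (pderiv 1 (pderiv 1 (u t))) p
        + u t p * pderiv 0 (u t) p = 0

/-- `‖u‖_{L^∞_T H^s}`. -/
def normLinftyHs (T s : ℝ) (u : ℝ → L2) : ℝ≥0∞ :=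
  essSup (fun t => hsNorm s (u t)) (volume.restrict (Set.Icc 0 T))

/-- `‖∇f‖_{L^∞} = ‖∂_x f‖_{L^∞} + ‖∂_y f‖_{L^∞}`. -/
def gradSupNorm (f : L2) : ℝ≥0∞ :=
  eLpNorm (pderiv 0 f) ∞ volume + eLpNorm (pderiv 1 f) ∞ volume

/-- `‖∇u‖_{L^1_T L^∞}`. -/
def normGradL1Linfty (T : ℝ) (u : ℝ → L2) : ℝ≥0∞ :=
  ∫⁻ t in Set.Icc 0 T, gradSupNorm (u t)

/-- On the domain of `multiplier m`, the Fourier transform of `m(D) f` is the symbol times the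
Fourier transform of `f`. -/
theorem fourier_multiplier (m : Plane → ℂ) (f : L2)
    (h : MemLp (fun ζ : Plane => m ((2 * Real.pi) • ζ) * (𝓕 f : L2) ζ) 2 volume) :
    ∀ᵐ ζ : Plane, (𝓕 (multiplier m f) : L2) ζ = m ((2 * Real.pi) • ζ) * (𝓕 f : L2) ζ := by
  have e : (𝓕 (multiplier m f) : L2) = h.toLp _ := by
    rw [multiplier, dif_pos h, FourierTransform.fourier_fourierInv_eq]
  rw [e]
  exact h.coeFn_toLp

/-- On its domain, `pderiv j` is the derivative in the sense of tempered distributions. -/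
theorem pderiv_eq_lineDeriv (j : Fin 2) (f : L2)
    (h : MemLp (fun ζ : Plane =>
      Complex.I * ((((2 * Real.pi) • ζ : Plane) j : ℝ) : ℂ) * (𝓕 f : L2) ζ) 2 volume) :
    (pderiv j f : 𝓢'(Plane, ℂ)) = ∂_{EuclideanSpace.single j (1 : ℝ)} (f : 𝓢'(Plane, ℂ)) := by
  have hF : 𝓕 (pderiv j f : 𝓢'(Plane, ℂ))
      = 𝓕 (∂_{EuclideanSpace.single j (1 : ℝ)} (f : 𝓢'(Plane, ℂ))) := by
    rw [TemperedDistribution.fourier_lineDerivOp_eq, Lp.fourier_toTemperedDistribution_eq,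
      Lp.fourier_toTemperedDistribution_eq]
    ext g
    have hg : (fun x : Plane =>
        ((inner ℝ x (EuclideanSpace.single j (1 : ℝ)) : ℝ) : ℂ)).HasTemperateGrowth := by
      fun_prop
    rw [smul_apply, TemperedDistribution.smulLeftCLM_apply_apply,
      Lp.toTemperedDistribution_apply, Lp.toTemperedDistribution_apply, ← integral_smul]
    apply integral_congr_ae
    filter_upwards [fourier_multiplier (fun p => Complex.I * (p j : ℂ)) f h] with ζ hζ
    change g ζ • (𝓕 (multiplier _ f) : L2) ζ = _
    rw [hζ, SchwartzMap.smulLeftCLM_apply_apply hg]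
    simp [EuclideanSpace.inner_single_right]
    ring
  have := congrArg (fun F : 𝓢'(Plane, ℂ) => 𝓕⁻ F) hF
  simpa using this

end

end FracBO

/-! Write `F` for the Fourier transform of `u(t)`. The dispersive terms have a purely imaginary
symbol, so they drop out of the time derivative of any energy `∫ w |F|²` with real weight `w`. What
remains is the real part of `⟨w F, F * (∂_x u)^⟩`, which has to be bounded by `‖∇u‖_∞ ‖u‖²_{H^s}`
with no loss of derivatives.

The weight is resolved into scales. By dilation, `⟨ζ⟩^{2s}` is a constant times `∫ l^{2s-1} b_l(ζ)²
dl`, where `b_l` localises to `l < ⟨ζ⟩ < 2l`. At a single scale (`exists_localized_bound`), split `u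
= Pu + Qu` with `Pu` at frequencies below `l/4`. The term `Qu u_x` is harmless, because `Qu` only
has frequencies above `l/8`. For `Pu u_x`, commute `b_l(D)` past `Pu`. The commutator gains a factor
`1/l` from the Lipschitz bound on `Pu`, and this pays for the derivative on the annulus. The rest is
`⟨b_l u, Pu ∂_x(b_l u)⟩`, where integration by parts moves the derivative to `Pu`, a real function.
Every term is at most `‖∇u‖_∞` times the mass of `F` in `{l ≤ 8⟨ζ⟩}`. Integrating this against
`l^{2s-1} dl` restores `⟨ζ⟩^{2s}`, since `s > 0` (`exists_weighted_bound`).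

The commutator estimate needs kernels with `L¹` norm and first moment controlled uniformly in the
scale. Since `⟨ζ⟩` is the length of `(2πζ, 1)`, the symbols are slices of dilated radial bumps in
three dimensions. The extra variable only contributes a phase, so a single Schwartz kernel serves
all scales.

As `u` is only differentiable in `L²`, the integral over scales stops at `l = R`, which makes the
weight bounded. The truncated energy is integrated in time, and Fatou's lemma lets `R → ∞`. The
supremum of the `H^s` norm stays on the right-hand side, so no Grönwall argument is needed. -/

namespace FracBO

open MeasureTheory Filter Topology SchwartzMap FourierTransform
open scoped ENNReal LineDeriv Convolution

noncomputable section

/-! ### Convolution, inversion and Plancherel on `L¹ ∩ L²` -/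

/-- Functions in `L¹ ∩ L²`. -/
structure IntegrableL2 (F : Plane → ℂ) : Prop where
  integrable : Integrable F
  memLp : MemLp F 2

/-- The convolution of complex-valued functions on the plane. -/
def conv (F G : Plane → ℂ) : Plane → ℂ := fun ζ => ∫ t, F t * G (ζ - t)

namespace IntegrableL2

variable {F G : Plane → ℂ}

theorem sub (hF : IntegrableL2 F) (hG : IntegrableL2 G) : IntegrableL2 (fun ζ => F ζ - G ζ) :=
  ⟨hF.1.sub hG.1, hF.2.sub hG.2⟩

theorem bdd_mul (hF : IntegrableL2 F) {m : Plane → ℂ} (hm : AEStronglyMeasurable m) (C : ℝ)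
    (hC : ∀ ζ, ‖m ζ‖ ≤ C) : IntegrableL2 (fun ζ => m ζ * F ζ) := by
  refine ⟨hF.1.bdd_mul hm (ae_of_all _ hC), ?_⟩
  refine (hF.2.const_mul (C : ℂ)).of_le (hm.mul hF.2.1) (ae_of_all _ fun ζ => ?_)
  rw [norm_mul, norm_mul]
  gcongr
  exact (hC ζ).trans (by simpa using le_abs_self C)

theorem integrable_norm_sq (hF : IntegrableL2 F) : Integrable (fun ζ => ‖F ζ‖ ^ 2) :=
  (memLp_two_iff_integrable_sq_norm hF.2.1).1 hF.2

theorem of_bounded (hF : Integrable F) (C : ℝ) (hC : ∀ ζ, ‖F ζ‖ ≤ C) : IntegrableL2 F := by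
  refine ⟨hF, (memLp_two_iff_integrable_sq_norm hF.1).2 ?_⟩
  refine (hF.norm.const_mul C).mono' (hF.1.norm.pow 2) (ae_of_all _ fun ζ => ?_)
  rw [Real.norm_of_nonneg (by positivity), pow_two]
  gcongr
  exact hC ζ

/-- Young's inequality for products bounds the convolution pointwise by the two `L²` norms. A
bounded integrable function is in `L²`. -/
theorem convolution (hF : IntegrableL2 F) (hG : IntegrableL2 G) :
    IntegrableL2 (conv F G) := by
  refine of_bounded (hF.1.integrable_convolution (ContinuousLinearMap.mul ℂ ℂ) hG.1)
    ((∫ ζ, ‖F ζ‖ ^ 2) / 2 + (∫ ζ, ‖G ζ‖ ^ 2) / 2) fun ζ => ?_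
  have h2 : Integrable (fun t => ‖G (ζ - t)‖ ^ 2) :=
    hG.integrable_norm_sq.comp_sub_left ζ
  rw [conv]
  calc ‖∫ t, F t * G (ζ - t)‖
      ≤ ∫ t, (‖F t‖ ^ 2 / 2 + ‖G (ζ - t)‖ ^ 2 / 2) := by
        refine norm_integral_le_of_norm_le
          ((hF.integrable_norm_sq.div_const 2).add (h2.div_const 2)) (ae_of_all _ fun t => ?_)
        rw [norm_mul]
        nlinarith [sq_nonneg (‖F t‖ - ‖G (ζ - t)‖)]
    _ = _ := by
        rw [integral_add (hF.integrable_norm_sq.div_const 2) (h2.div_const 2), integral_div,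
          integral_div]
        congr 2
        exact integral_sub_left_eq_self (fun t => ‖G t‖ ^ 2) volume ζ

end IntegrableL2

theorem continuous_fourierInv {F : Plane → ℂ} (hF : Integrable F) : Continuous (𝓕⁻ F) := by
  apply VectorFourier.fourierIntegral_continuous Real.continuous_fourierChar
  · exact (continuous_inner (𝕜 := ℝ) (E := Plane)).neg
  · exact hF

theorem norm_fourierInv_le (F : Plane → ℂ) (x : Plane) : ‖𝓕⁻ F x‖ ≤ ∫ ζ, ‖F ζ‖ :=
  VectorFourier.norm_fourierIntegral_le_integral_norm _ _ _ _ _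

theorem fourierInv_conv {F G : Plane → ℂ} (hF : Integrable F) (hG : Integrable G) (x : Plane) :
    𝓕⁻ (conv F G) x = 𝓕⁻ F x * 𝓕⁻ G x := by
  simp_rw [Real.fourierInv_eq_fourier_neg]
  exact Real.fourier_mul_convolution_eq hF hG (-x)

theorem integral_fourierInv_mul {F H : Plane → ℂ} (hF : Integrable F) (hH : Integrable H) :
    ∫ x, 𝓕⁻ H x * F x = ∫ x, H x * 𝓕⁻ F x := by
  have := VectorFourier.integral_fourierIntegral_smul_eq_flip (μ := (volume : Measure Plane))
    (ν := (volume : Measure Plane)) (L := -innerₗ Plane) Real.continuous_fourierChar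
    ((continuous_inner (𝕜 := ℝ) (E := Plane)).neg) hH hF
  have e : (-innerₗ Plane).flip = -innerₗ Plane := by
    ext x y; simp [real_inner_comm]
  rw [e] at this
  exact this

/-- The inverse Fourier transforms on `L²` and on `L¹` agree on `L¹ ∩ L²`. -/
theorem fourierInv_ae_eq (F : L2) (hF : Integrable F) :
    (𝓕⁻ F : L2) =ᵐ[volume] 𝓕⁻ (F : Plane → ℂ) := by
  -- It suffices to test against smooth compactly supported functions. These are Schwartz functions,
  -- to which both transforms can be moved by duality.
  apply ae_eq_of_integral_contDiff_smul_eq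
  · exact (Lp.memLp _).locallyIntegrable (by norm_num)
  · exact (continuous_fourierInv hF).locallyIntegrable
  intro g hg hc
  have hg₁ : HasCompactSupport (Complex.ofRealCLM ∘ g) := hc.comp_left rfl
  have hg₂ : ContDiff ℝ ((⊤ : ℕ∞) : WithTop ℕ∞) (Complex.ofRealCLM ∘ g) := by fun_prop
  set φ : 𝓢(Plane, ℂ) := hg₁.toSchwartzMap hg₂ with hφ
  have e : ((𝓕⁻ F : L2) : 𝓢'(Plane, ℂ)) φ = (F : 𝓢'(Plane, ℂ)) (𝓕⁻ φ) := by
    rw [← Lp.fourierInv_toTemperedDistribution_eq, TemperedDistribution.fourierInv_apply]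
  rw [Lp.toTemperedDistribution_apply, Lp.toTemperedDistribution_apply] at e
  have e2 := integral_fourierInv_mul hF φ.integrable
  rw [← SchwartzMap.fourierInv_coe] at e2
  calc ∫ x, g x • (𝓕⁻ F : L2) x = ∫ x, φ x • (𝓕⁻ F : L2) x := by
        simp [hφ]
    _ = _ := by
        rw [e]
        simp only [smul_eq_mul]
        rw [e2]
        simp [hφ]

theorem fourierInv_congr {F G : Plane → ℂ} (h : F =ᵐ[volume] G) : 𝓕⁻ F = 𝓕⁻ G :=
  funext fun x => Real.fourierInv_congr_ae h x

theorem toLp_fourierInv_ae_eq {F : Plane → ℂ} (hF : IntegrableL2 F) :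
    (𝓕⁻ (hF.memLp.toLp F) : L2) =ᵐ[volume] 𝓕⁻ F := by
  have h := hF.memLp.coeFn_toLp
  refine (fourierInv_ae_eq _ (hF.integrable.congr h.symm)).trans ?_
  rw [fourierInv_congr h]

namespace IntegrableL2
variable {F G : Plane → ℂ}

theorem memLp_fourierInv (hF : IntegrableL2 F) : MemLp (𝓕⁻ F) 2 :=
  (memLp_congr_ae (toLp_fourierInv_ae_eq hF)).1 (Lp.memLp _)

theorem integrable_norm_sq_fourierInv (hF : IntegrableL2 F) :
    Integrable (fun x => ‖𝓕⁻ F x‖ ^ 2) :=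
  (memLp_two_iff_integrable_sq_norm hF.memLp_fourierInv.1).1 hF.memLp_fourierInv

theorem inner_integrable (hF : IntegrableL2 F) (hG : IntegrableL2 G) :
    Integrable (fun ζ => inner ℂ (F ζ) (G ζ)) := by
  have := L2.integrable_inner (𝕜 := ℂ) (hF.memLp.toLp F) (hG.memLp.toLp G)
  refine this.congr ?_
  filter_upwards [hF.memLp.coeFn_toLp, hG.memLp.coeFn_toLp] with x h1 h2
  rw [h1, h2]

/-- Plancherel's theorem on `L¹ ∩ L²`. -/
theorem integral_inner_fourierInv (hF : IntegrableL2 F) (hG : IntegrableL2 G) :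
    ∫ x, inner ℂ (𝓕⁻ F x) (𝓕⁻ G x) = ∫ ζ, inner ℂ (F ζ) (G ζ) := by
  have h : inner ℂ (𝓕⁻ (hF.memLp.toLp F) : L2) (𝓕⁻ (hG.memLp.toLp G) : L2)
      = inner ℂ (hF.memLp.toLp F) (hG.memLp.toLp G) := by
    rw [← Lp.inner_fourier_eq, fourier_fourierInv_eq, fourier_fourierInv_eq]
  rw [L2.inner_def, L2.inner_def] at h
  calc _ = _ := integral_congr_ae ?_
    _ = _ := h
    _ = _ := integral_congr_ae ?_
  · filter_upwards [toLp_fourierInv_ae_eq hF, toLp_fourierInv_ae_eq hG] with x h1 h2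
    rw [h1, h2]
  · filter_upwards [hF.memLp.coeFn_toLp, hG.memLp.coeFn_toLp] with x h1 h2
    rw [h1, h2]

theorem integral_norm_sq_fourierInv (hF : IntegrableL2 F) :
    ∫ x, ‖𝓕⁻ F x‖ ^ 2 = ∫ ζ, ‖F ζ‖ ^ 2 := by
  have h := hF.integral_inner_fourierInv hF
  have e : ∀ z : ℂ, inner ℂ z z = ((‖z‖ ^ 2 : ℝ) : ℂ) := fun z => by
    rw [inner_self_eq_norm_sq_to_K]; norm_cast
  have e' : ∀ g : Plane → ℂ, ∫ x, inner ℂ (g x) (g x) = ((∫ x, ‖g x‖ ^ 2 : ℝ) : ℂ) := fun g => by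
    rw [← integral_complex_ofReal]
    exact integral_congr_ae (ae_of_all _ fun x => e (g x))
  rw [e', e'] at h
  exact_mod_cast h

end IntegrableL2

/-- The Fourier multiplier whose symbol is a superposition of characters is a superposition of
translations. -/
theorem fourierInv_superposition {Ω : Type*} [MeasurableSpace Ω] {μ : Measure Ω} [SFinite μ]
    {κ : Ω → ℂ} (hκ : Integrable κ μ) {y : Ω → Plane} (hy : Measurable y)
    {F : Plane → ℂ} (hF : Integrable F) (x : Plane) :
    𝓕⁻ (fun ζ => (∫ v, κ v * (Real.fourierChar (inner ℝ ζ (y v)) : ℂ) ∂μ) * F ζ) x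
      = ∫ v, κ v * 𝓕⁻ F (x + y v) ∂μ := by
  have hm : Measurable (fun q : Plane × Ω =>
      (Real.fourierChar (inner ℝ q.1 (x + y q.2)) : ℂ)) := by
    have : Measurable fun q : Plane × Ω => inner ℝ q.1 (x + y q.2) := by fun_prop
    exact (continuous_subtype_val.comp Real.continuous_fourierChar).measurable.comp this
  have hi : Integrable (Function.uncurry fun (ζ : Plane) (v : Ω) =>
      (Real.fourierChar (inner ℝ ζ (x + y v)) : ℂ) * (F ζ * κ v)) (volume.prod μ) := by
    refine (hF.mul_prod hκ).bdd_mul (c := 1) hm.aestronglyMeasurable (ae_of_all _ fun q => ?_)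
    exact (Circle.norm_coe _).le
  have hswap := integral_integral_swap hi
  rw [Real.fourierInv_eq]
  calc _ = ∫ ζ, ∫ v, (Real.fourierChar (inner ℝ ζ (x + y v)) : ℂ) * (F ζ * κ v) ∂μ := by
        congr 1
        ext ζ
        rw [Circle.smul_def, smul_eq_mul, mul_left_comm, ← mul_assoc, ← integral_mul_const,
          ← integral_mul_const]
        congr 1
        ext v
        rw [inner_add_right, AddChar.map_add_eq_mul, Circle.coe_mul]
        ring
    _ = _ := hswap
    _ = _ := by
        congr 1
        ext v
        rw [Real.fourierInv_eq, ← integral_const_mul]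
        congr 1
        ext ζ
        rw [Circle.smul_def, smul_eq_mul]
        ring

/-! ### Derivatives on the Fourier side, Lipschitz bounds and integration by parts -/

/-- The Fourier-side action of the `j`-th partial derivative. -/
def freqDeriv (j : Fin 2) (F : Plane → ℂ) : Plane → ℂ :=
  fun ζ => Complex.I * ((2 * Real.pi * ζ j : ℝ) : ℂ) * F ζ

theorem freqDeriv_mul (j : Fin 2) (m F : Plane → ℂ) :
    freqDeriv j (fun ζ => m ζ * F ζ) = fun ζ => m ζ * freqDeriv j F ζ := by
  ext ζ; simp only [freqDeriv]; ring

theorem norm_mul_norm_le_freqDeriv (F : Plane → ℂ) (ζ : Plane) :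
    ‖ζ‖ * ‖F ζ‖ ≤ ‖freqDeriv 0 F ζ‖ + ‖freqDeriv 1 F ζ‖ := by
  simp only [freqDeriv, norm_mul, Complex.norm_I, one_mul, Complex.norm_real, ← add_mul]
  gcongr
  have h : ‖ζ‖ ≤ ‖ζ 0‖ + ‖ζ 1‖ := by
    rw [EuclideanSpace.norm_eq, Fin.sum_univ_two]
    apply Real.sqrt_le_iff.2
    constructor
    · positivity
    · nlinarith [norm_nonneg (ζ 0), norm_nonneg (ζ 1)]
  have hp : (1 : ℝ) ≤ ‖Real.pi‖ := by
    rw [Real.norm_of_nonneg Real.pi_pos.le]; linarith [Real.pi_gt_three]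
  have h2 : ‖(2 : ℝ)‖ = 2 := by norm_num
  rw [h2]
  nlinarith [norm_nonneg (ζ 0), norm_nonneg (ζ 1)]

theorem hasFDerivAt_fourierInv {F : Plane → ℂ} (hF : Integrable F)
    (h0 : Integrable (freqDeriv 0 F)) (h1 : Integrable (freqDeriv 1 F)) (x : Plane) :
    ∃ L : Plane →L[ℝ] ℂ, HasFDerivAt (𝓕⁻ F) L x ∧
      ∀ y, L y = (y 0 : ℂ) * 𝓕⁻ (freqDeriv 0 F) x + (y 1 : ℂ) * 𝓕⁻ (freqDeriv 1 F) x := by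
  have hv : Integrable (fun ζ => ‖ζ‖ * ‖F ζ‖) := by
    refine (h0.norm.add h1.norm).mono' (by fun_prop) (ae_of_all _ fun ζ => ?_)
    rw [Real.norm_of_nonneg (by positivity)]
    exact norm_mul_norm_le_freqDeriv F ζ
  have hd := Real.hasFDerivAt_fourier hF hv (-x)
  have hneg : HasFDerivAt (fun z : Plane => -z) (-ContinuousLinearMap.id ℝ Plane) x :=
    (hasFDerivAt_id x).neg
  have hc := HasFDerivAt.comp x hd hneg
  have e : 𝓕⁻ F = 𝓕 F ∘ fun z => -z := funext fun z => Real.fourierInv_eq_fourier_neg F z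
  rw [← e] at hc
  refine ⟨_, hc, fun y => ?_⟩
  have hs : Integrable (VectorFourier.fourierSMulRight (innerSL ℝ) F) := by
    refine (hv.const_mul (2 * Real.pi * ‖innerSL (E := Plane) ℝ‖)).mono'
      hF.1.fourierSMulRight (ae_of_all _ fun ζ => ?_)
    refine (VectorFourier.norm_fourierSMulRight_le _ _ _).trans (le_of_eq (by ring))
  have happ := Real.fourier_continuousLinearMap_apply (f := VectorFourier.fourierSMulRight
    (innerSL ℝ) F) (a := -y) (v := -x) hs
  have i0 := (Real.fourierIntegral_convergent_iff (-x)).2 h0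
  have i1 := (Real.fourierIntegral_convergent_iff (-x)).2 h1
  calc _ = 𝓕 (VectorFourier.fourierSMulRight (innerSL ℝ) F) (-x) (-y) := by simp
    _ = _ := happ
    _ = _ := by
      simp_rw [Real.fourierInv_eq_fourier_neg, Real.fourier_eq]
      rw [← integral_const_mul, ← integral_const_mul, ← integral_add (i0.const_mul _)
        (i1.const_mul _)]
      congr 1
      ext ζ
      simp only [VectorFourier.fourierSMulRight_apply, freqDeriv, inner_neg_right, neg_neg,
        PiLp.inner_apply, Fin.sum_univ_two, Circle.smul_def,
        smul_eq_mul, Complex.real_smul]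
      have e : ((innerSL ℝ) ζ y : ℝ) = ζ 0 * y 0 + ζ 1 * y 1 := by
        rw [innerSL_apply_apply, PiLp.inner_apply, Fin.sum_univ_two]
        simp [mul_comm]
      simp [e]
      ring

/-- Mean value inequality: the operator norm of the differential is at most the sum of the moduli of
the two partial derivatives. -/
theorem norm_fourierInv_sub_le {F : Plane → ℂ} (hF : Integrable F)
    (h0 : Integrable (freqDeriv 0 F)) (h1 : Integrable (freqDeriv 1 F)) {Γ : ℝ}
    (hΓ : ∀ x, ‖𝓕⁻ (freqDeriv 0 F) x‖ + ‖𝓕⁻ (freqDeriv 1 F) x‖ ≤ Γ) (x y : Plane) :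
    ‖𝓕⁻ F (x + y) - 𝓕⁻ F x‖ ≤ Γ * ‖y‖ := by
  choose L hL hLy using hasFDerivAt_fourierInv hF h0 h1
  have := convex_univ.norm_image_sub_le_of_norm_hasFDerivWithin_le (C := Γ)
    (fun z _ => (hL z).hasFDerivWithinAt) (fun z _ => ?_) (Set.mem_univ x) (Set.mem_univ (x + y))
  · simpa using this
  refine ContinuousLinearMap.opNorm_le_bound _ ?_ fun v => ?_
  · exact (by positivity : (0 : ℝ) ≤ _).trans (hΓ z)
  rw [hLy]
  have a0 : ‖(v 0 : ℂ)‖ ≤ ‖v‖ := by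
    rw [Complex.norm_real]; exact PiLp.norm_apply_le v 0
  have a1 : ‖(v 1 : ℂ)‖ ≤ ‖v‖ := by
    rw [Complex.norm_real]; exact PiLp.norm_apply_le v 1
  calc _ ≤ ‖(v 0 : ℂ)‖ * ‖𝓕⁻ (freqDeriv 0 F) z‖ + ‖(v 1 : ℂ)‖ * ‖𝓕⁻ (freqDeriv 1 F) z‖ := by
        refine (norm_add_le _ _).trans ?_
        rw [norm_mul, norm_mul]
    _ ≤ ‖v‖ * ‖𝓕⁻ (freqDeriv 0 F) z‖ + ‖v‖ * ‖𝓕⁻ (freqDeriv 1 F) z‖ := by gcongr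
    _ = (‖𝓕⁻ (freqDeriv 0 F) z‖ + ‖𝓕⁻ (freqDeriv 1 F) z‖) * ‖v‖ := by ring
    _ ≤ _ := by gcongr; exact hΓ z

namespace IntegrableL2
variable {A F G W : Plane → ℂ}

theorem integrable_mul_comp_sub (hF : IntegrableL2 F) (hG : IntegrableL2 G) (ζ : Plane) :
    Integrable (fun t => F t * G (ζ - t)) := by
  have h : MemLp (fun t => G (ζ - t)) 2 :=
    hG.memLp.comp_measurePreserving (Measure.measurePreserving_sub_left volume ζ)
  exact hF.memLp.integrable_mul h

/-- The Leibniz rule, from splitting the frequency as `ζ = t + (ζ - t)` under the integral. -/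
theorem freqDeriv_conv (hA : IntegrableL2 A) (hA' : IntegrableL2 (freqDeriv 0 A))
    (hW : IntegrableL2 W) (hW' : IntegrableL2 (freqDeriv 0 W)) (ζ : Plane) :
    freqDeriv 0 (conv A W) ζ = conv (freqDeriv 0 A) W ζ + conv A (freqDeriv 0 W) ζ := by
  rw [freqDeriv]
  simp only [conv]
  rw [← integral_const_mul, ← integral_add (hA'.integrable_mul_comp_sub hW ζ)
    (hA.integrable_mul_comp_sub hW' ζ)]
  congr 1
  ext t
  simp only [freqDeriv, PiLp.sub_apply]
  push_cast
  ring

/-- Integration by parts in the transport term. -/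
theorem abs_re_integral_transport_le (hA : IntegrableL2 A) (hA' : IntegrableL2 (freqDeriv 0 A))
    (hW : IntegrableL2 W) (hW' : IntegrableL2 (freqDeriv 0 W))
    (hreal : ∀ x, (𝓕⁻ A x).im = 0) {M : ℝ} (hM : ∀ x, ‖𝓕⁻ (freqDeriv 0 A) x‖ ≤ M) :
    |(∫ ζ, inner ℂ (W ζ) (conv A (freqDeriv 0 W) ζ)).re| ≤ M / 2 * ∫ ζ, ‖W ζ‖ ^ 2 := by
  have e1 : ∫ ζ, inner ℂ (W ζ) (conv A (freqDeriv 0 W) ζ)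
      = ∫ x, inner ℂ (𝓕⁻ W x) (𝓕⁻ A x * 𝓕⁻ (freqDeriv 0 W) x) := by
    rw [← hW.integral_inner_fourierInv (hA.convolution hW')]
    simp_rw [fourierInv_conv hA.1 hW'.1]
  have e2 : ∫ ζ, inner ℂ (freqDeriv 0 W ζ) (conv A W ζ)
      = ∫ x, inner ℂ (𝓕⁻ (freqDeriv 0 W) x) (𝓕⁻ A x * 𝓕⁻ W x) := by
    rw [← hW'.integral_inner_fourierInv (hA.convolution hW)]
    simp_rw [fourierInv_conv hA.1 hW.1]
  have e3 : ∫ ζ, inner ℂ (W ζ) (conv (freqDeriv 0 A) W ζ)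
      = ∫ x, inner ℂ (𝓕⁻ W x) (𝓕⁻ (freqDeriv 0 A) x * 𝓕⁻ W x) := by
    rw [← hW.integral_inner_fourierInv (hA'.convolution hW)]
    simp_rw [fourierInv_conv hA'.1 hW.1]
  -- The Leibniz rule combined with the skew-adjointness of `∂_x`, whose symbol is imaginary.
  have h1 : (∫ ζ, inner ℂ (W ζ) (conv A (freqDeriv 0 W) ζ))
      + ∫ ζ, inner ℂ (freqDeriv 0 W ζ) (conv A W ζ)
      = - ∫ ζ, inner ℂ (W ζ) (conv (freqDeriv 0 A) W ζ) := by
    rw [← integral_add (hW.inner_integrable (hA.convolution hW'))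
      (hW'.inner_integrable (hA.convolution hW)), ← integral_neg]
    congr 1
    ext ζ
    have h := freqDeriv_conv hA hA' hW hW' ζ
    have h' : conv A (freqDeriv 0 W) ζ
        = freqDeriv 0 (conv A W) ζ - conv (freqDeriv 0 A) W ζ := by rw [h]; ring
    rw [h']
    simp only [RCLike.inner_apply, freqDeriv, map_mul, Complex.conj_I, Complex.conj_ofReal]
    ring
  -- Multiplication by a real function is symmetric, so the two terms on the left of `h1` are
  -- conjugate and add up to twice the real part.
  have h2 : ∫ ζ, inner ℂ (freqDeriv 0 W ζ) (conv A W ζ)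
      = (starRingEnd ℂ) (∫ ζ, inner ℂ (W ζ) (conv A (freqDeriv 0 W) ζ)) := by
    rw [e1, e2, ← integral_conj]
    congr 1
    ext x
    have : (starRingEnd ℂ) (𝓕⁻ A x) = 𝓕⁻ A x := Complex.conj_eq_iff_im.2 (hreal x)
    simp only [RCLike.inner_apply, map_mul, Complex.conj_conj, this]
    ring
  rw [h2] at h1
  have h3 : 2 * (∫ ζ, inner ℂ (W ζ) (conv A (freqDeriv 0 W) ζ)).re
      = - (∫ ζ, inner ℂ (W ζ) (conv (freqDeriv 0 A) W ζ)).re := by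
    have := congrArg Complex.re h1
    simp only [Complex.add_re, Complex.conj_re, Complex.neg_re] at this
    linarith
  have h4 : ‖∫ ζ, inner ℂ (W ζ) (conv (freqDeriv 0 A) W ζ)‖ ≤ M * ∫ ζ, ‖W ζ‖ ^ 2 := by
    rw [e3, ← hW.integral_norm_sq_fourierInv, ← integral_const_mul]
    refine norm_integral_le_of_norm_le (hW.integrable_norm_sq_fourierInv.const_mul M)
      (ae_of_all _ fun x => ?_)
    refine (norm_inner_le_norm _ _).trans ?_
    rw [norm_mul]
    calc _ = ‖𝓕⁻ (freqDeriv 0 A) x‖ * ‖𝓕⁻ W x‖ ^ 2 := by ring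
      _ ≤ _ := by gcongr; exact hM x
  have h5 := (Complex.abs_re_le_norm _).trans h4
  rw [abs_le] at h5 ⊢
  constructor <;> linarith [h5.1, h5.2]

end IntegrableL2

/-! ### Superpositions of translations, the commutator and the localised estimate -/

section Superposition

variable {Ω : Type*} [MeasurableSpace Ω] {μ : Measure Ω}

/-- The symbol of a superposition of translations. -/
def superSymbol (μ : Measure Ω) (κ : Ω → ℂ) (y : Ω → Plane) (ζ : Plane) : ℂ :=
  ∫ v, κ v * (Real.fourierChar (inner ℝ ζ (y v)) : ℂ) ∂μ

theorem norm_superSymbol_le (κ : Ω → ℂ) (y : Ω → Plane) (ζ : Plane) :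
    ‖superSymbol μ κ y ζ‖ ≤ ∫ v, ‖κ v‖ ∂μ := by
  refine (norm_integral_le_integral_norm _).trans (le_of_eq ?_)
  congr 1; ext v
  rw [norm_mul, Circle.norm_coe, mul_one]

variable {κ : Ω → ℂ} {y : Ω → Plane}

theorem fourierInv_superSymbol_mul [SFinite μ] (hκ : Integrable κ μ) (hy : Measurable y)
    {F : Plane → ℂ} (hF : Integrable F) (x : Plane) :
    𝓕⁻ (fun ζ => superSymbol μ κ y ζ * F ζ) x = ∫ v, κ v * 𝓕⁻ F (x + y v) ∂μ :=
  fourierInv_superposition hκ hy hF x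

theorem integrable_mul_fourierInv_add (hκ : Integrable κ μ) (hy : Measurable y)
    {F : Plane → ℂ} (hF : Integrable F) (x : Plane) :
    Integrable (fun v => κ v * 𝓕⁻ F (x + y v)) μ := by
  have hm : AEStronglyMeasurable (fun v => 𝓕⁻ F (x + y v)) μ :=
    ((continuous_fourierInv hF).measurable.comp (hy.const_add x)).aestronglyMeasurable
  have := hκ.bdd_mul hm (ae_of_all _ fun v => norm_fourierInv_le F (x + y v))
  simpa only [mul_comm] using this

theorem norm_fourierInv_superSymbol_mul_le [SFinite μ] (hκ : Integrable κ μ) (hy : Measurable y)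
    {F : Plane → ℂ} (hF : Integrable F) {M : ℝ} (hM : ∀ x, ‖𝓕⁻ F x‖ ≤ M) (x : Plane) :
    ‖𝓕⁻ (fun ζ => superSymbol μ κ y ζ * F ζ) x‖ ≤ (∫ v, ‖κ v‖ ∂μ) * M := by
  rw [fourierInv_superSymbol_mul hκ hy hF, ← integral_mul_const]
  refine norm_integral_le_of_norm_le (hκ.norm.mul_const M) (ae_of_all _ fun v => ?_)
  rw [norm_mul]
  gcongr
  exact hM _

/-- Averaging translates against a real kernel keeps a function real. The low-frequency part has to
be real for the integration by parts. -/
theorem im_fourierInv_superSymbol_mul [SFinite μ] (hκ : Integrable κ μ) (hy : Measurable y)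
    (hκr : ∀ v, (κ v).im = 0) {F : Plane → ℂ} (hF : Integrable F)
    (hr : ∀ x, (𝓕⁻ F x).im = 0) (x : Plane) :
    (𝓕⁻ (fun ζ => superSymbol μ κ y ζ * F ζ) x).im = 0 := by
  rw [fourierInv_superSymbol_mul hκ hy hF]
  have h := integral_im (integrable_mul_fourierInv_add hκ hy hF x)
  have h' : (∫ v, κ v * 𝓕⁻ F (x + y v) ∂μ).im = ∫ v, (κ v * 𝓕⁻ F (x + y v)).im ∂μ := h.symm
  rw [h']
  simp [Complex.mul_im, hκr, hr]

theorem norm_fourierInv_superSymbol_mul_sub_le [SFinite μ] (hκ : Integrable κ μ) (hy : Measurable y)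
    {F : Plane → ℂ} (hF : Integrable F) {L : ℝ}
    (hL : ∀ x z, ‖𝓕⁻ F (x + z) - 𝓕⁻ F x‖ ≤ L * ‖z‖) (x z : Plane) :
    ‖𝓕⁻ (fun ζ => superSymbol μ κ y ζ * F ζ) (x + z)
      - 𝓕⁻ (fun ζ => superSymbol μ κ y ζ * F ζ) x‖ ≤ (∫ v, ‖κ v‖ ∂μ) * L * ‖z‖ := by
  rw [fourierInv_superSymbol_mul hκ hy hF, fourierInv_superSymbol_mul hκ hy hF,
    ← integral_sub (integrable_mul_fourierInv_add hκ hy hF _)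
      (integrable_mul_fourierInv_add hκ hy hF _), mul_assoc, ← integral_mul_const]
  refine norm_integral_le_of_norm_le (hκ.norm.mul_const _) (ae_of_all _ fun v => ?_)
  rw [← mul_sub, norm_mul]
  gcongr
  have := hL (x + y v) z
  rwa [add_right_comm] at this

/-- The Calderón commutator estimate, as a bound on a bilinear form. -/
theorem norm_integral_commutator_le [SFinite μ] (hκ : Integrable κ μ) (hy : Measurable y)
    (hκy : Integrable (fun v => ‖κ v‖ * ‖y v‖) μ) {A G W : Plane → ℂ}
    (hm : AEStronglyMeasurable (superSymbol μ κ y))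
    (hA : IntegrableL2 A) (hG : IntegrableL2 G) (hW : IntegrableL2 W) {L : ℝ} (hL0 : 0 ≤ L)
    (hL : ∀ x z, ‖𝓕⁻ A (x + z) - 𝓕⁻ A x‖ ≤ L * ‖z‖) {θ : ℝ} (hθ : 0 < θ) :
    ‖∫ ζ, inner ℂ (W ζ) (superSymbol μ κ y ζ * conv A G ζ
        - conv A (fun ζ => superSymbol μ κ y ζ * G ζ) ζ)‖ ≤
      L * (∫ v, ‖κ v‖ * ‖y v‖ ∂μ) / 2 * (θ * (∫ ζ, ‖W ζ‖ ^ 2) + θ⁻¹ * ∫ ζ, ‖G ζ‖ ^ 2) := by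
  have hAG := hA.convolution hG
  have hmG := hG.bdd_mul hm _ (norm_superSymbol_le κ y)
  have h1 := hAG.bdd_mul hm _ (norm_superSymbol_le κ y)
  have h2 := hA.convolution hmG
  rw [← hW.integral_inner_fourierInv (h1.sub h2)]
  -- In physical space the commutator averages the increments of `A` against translates of `G`. Each
  -- increment costs one factor `‖y v‖`, which the first moment of the kernel absorbs.
  have hpt : ∀ x, 𝓕⁻ (fun ζ => superSymbol μ κ y ζ * conv A G ζ
      - conv A (fun ζ => superSymbol μ κ y ζ * G ζ) ζ) x
      = ∫ v, κ v * ((𝓕⁻ A (x + y v) - 𝓕⁻ A x) * 𝓕⁻ G (x + y v)) ∂μ := by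
    intro x
    have hs : 𝓕⁻ (fun ζ => superSymbol μ κ y ζ * conv A G ζ
        - conv A (fun ζ => superSymbol μ κ y ζ * G ζ) ζ) x
        = 𝓕⁻ (fun ζ => superSymbol μ κ y ζ * conv A G ζ) x
          - 𝓕⁻ (conv A (fun ζ => superSymbol μ κ y ζ * G ζ)) x := by
      simp_rw [Real.fourierInv_eq, smul_sub]
      rw [integral_sub]
      · have := (Real.fourierIntegral_convergent_iff (-x)).2 h1.1
        simpa using this
      · have := (Real.fourierIntegral_convergent_iff (-x)).2 h2.1
        simpa using this
    rw [hs, fourierInv_superSymbol_mul hκ hy hAG.1, fourierInv_conv hA.1 hmG.1,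
      fourierInv_superSymbol_mul hκ hy hG.1, ← integral_const_mul, ← integral_sub
        (integrable_mul_fourierInv_add hκ hy hAG.1 x)
        ((integrable_mul_fourierInv_add hκ hy hG.1 x).const_mul _)]
    congr 1; ext v
    rw [fourierInv_conv hA.1 hG.1]
    ring
  simp_rw [hpt]
  have hgm : Measurable (fun q : Plane × Ω => 𝓕⁻ G (q.1 + y q.2)) :=
    (continuous_fourierInv hG.1).measurable.comp (by fun_prop)
  set w : Ω → ℝ := fun v => ‖κ v‖ * ‖y v‖ with hw
  have hI1 : Integrable (fun q : Plane × Ω => ‖𝓕⁻ W q.1‖ ^ 2 * w q.2) (volume.prod μ) :=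
    hW.integrable_norm_sq_fourierInv.mul_prod hκy
  have hI2 : Integrable (fun q : Plane × Ω => ‖𝓕⁻ G (q.1 + y q.2)‖ ^ 2 * w q.2)
      (volume.prod μ) := by
    refine (integrable_prod_iff' ?_).2 ⟨ae_of_all _ fun v => ?_, ?_⟩
    · exact ((hgm.norm.pow_const 2).aestronglyMeasurable).mul hκy.1.comp_snd
    · exact (hG.integrable_norm_sq_fourierInv.comp_add_right (y v)).mul_const (w v)
    · have : ∀ v, ∫ x, ‖‖𝓕⁻ G (x + y v)‖ ^ 2 * w v‖ = (∫ x, ‖𝓕⁻ G x‖ ^ 2) * w v := by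
        intro v
        have hn : ∀ x, ‖‖𝓕⁻ G (x + y v)‖ ^ 2 * w v‖ = ‖𝓕⁻ G (x + y v)‖ ^ 2 * w v := fun x =>
          Real.norm_of_nonneg (by positivity)
        simp_rw [hn]
        rw [integral_mul_const, integral_add_right_eq_self (fun x => ‖𝓕⁻ G x‖ ^ 2)]
      simp only [this]
      exact hκy.const_mul _
  have hv2 : ∫ q, ‖𝓕⁻ G (q.1 + y q.2)‖ ^ 2 * w q.2 ∂(volume.prod μ)
      = (∫ ζ, ‖G ζ‖ ^ 2) * ∫ v, w v ∂μ := by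
    rw [integral_prod_symm _ hI2, ← hG.integral_norm_sq_fourierInv, ← integral_const_mul]
    congr 1; ext v
    simp only
    rw [integral_mul_const, integral_add_right_eq_self (fun x => ‖𝓕⁻ G x‖ ^ 2)]
  have hv1 : ∫ q, ‖𝓕⁻ W q.1‖ ^ 2 * w q.2 ∂((volume : Measure Plane).prod μ)
      = (∫ ζ, ‖W ζ‖ ^ 2) * ∫ v, w v ∂μ := by
    rw [integral_prod_mul (fun x => ‖𝓕⁻ W x‖ ^ 2) w, hW.integral_norm_sq_fourierInv]
  have hI : Integrable (fun q : Plane × Ω => L / 2 * θ * (‖𝓕⁻ W q.1‖ ^ 2 * w q.2)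
      + L / 2 * θ⁻¹ * (‖𝓕⁻ G (q.1 + y q.2)‖ ^ 2 * w q.2)) (volume.prod μ) :=
    (hI1.const_mul (L / 2 * θ)).add (hI2.const_mul (L / 2 * θ⁻¹))
  calc _ ≤ ∫ x, ∫ v, (L / 2 * θ * (‖𝓕⁻ W x‖ ^ 2 * w v)
        + L / 2 * θ⁻¹ * (‖𝓕⁻ G (x + y v)‖ ^ 2 * w v)) ∂μ := by
        refine norm_integral_le_of_norm_le hI.integral_prod_left ?_
        filter_upwards [hI.prod_right_ae] with x hx
        refine (norm_inner_le_norm _ _).trans ?_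
        rw [mul_comm, ← norm_mul, ← integral_mul_const]
        refine norm_integral_le_of_norm_le hx (ae_of_all _ fun v => ?_)
        rw [norm_mul, norm_mul, norm_mul]
        -- Weighted Young inequality. The free parameter `θ` later balances `W` against `G`, which
        -- is larger by one derivative.
        have hsq : ‖𝓕⁻ G (x + y v)‖ * ‖𝓕⁻ W x‖
            ≤ (θ * ‖𝓕⁻ W x‖ ^ 2 + θ⁻¹ * ‖𝓕⁻ G (x + y v)‖ ^ 2) / 2 := by
          have h := mul_nonneg (inv_nonneg.2 hθ.le)
            (sq_nonneg (θ * ‖𝓕⁻ W x‖ - ‖𝓕⁻ G (x + y v)‖))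
          have e : θ⁻¹ * (θ * ‖𝓕⁻ W x‖ - ‖𝓕⁻ G (x + y v)‖) ^ 2 = θ * ‖𝓕⁻ W x‖ ^ 2
              + θ⁻¹ * ‖𝓕⁻ G (x + y v)‖ ^ 2 - 2 * (‖𝓕⁻ G (x + y v)‖ * ‖𝓕⁻ W x‖) := by
            field_simp; ring
          linarith
        calc _ = ‖κ v‖ * ‖𝓕⁻ A (x + y v) - 𝓕⁻ A x‖ * (‖𝓕⁻ G (x + y v)‖ * ‖𝓕⁻ W x‖) := by ring
          _ ≤ ‖κ v‖ * (L * ‖y v‖)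
              * ((θ * ‖𝓕⁻ W x‖ ^ 2 + θ⁻¹ * ‖𝓕⁻ G (x + y v)‖ ^ 2) / 2) := by
            gcongr
            exact hL x (y v)
          _ = _ := by simp only [hw]; ring
    _ = _ := by
        have e := integral_prod _ hI
        simp only at e
        rw [← e, integral_add (hI1.const_mul _) (hI2.const_mul _), integral_const_mul,
          integral_const_mul, hv1, hv2]
        ring

variable {b p χ : Plane → ℝ} {κp : Ω → ℂ}

/-- The frequency-localised energy estimate for the Burgers nonlinearity: `b` localises to an
annulus, `p` to a smaller ball. -/
theorem abs_re_integral_localized_le [SFinite μ] (hκ : Integrable κ μ) (hκp : Integrable κp μ)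
    (hy : Measurable y) (hκy : Integrable (fun v => ‖κ v‖ * ‖y v‖) μ)
    (hκr : ∀ v, (κp v).im = 0)
    (hb : ∀ ζ, (b ζ : ℂ) = superSymbol μ κ y ζ) (hp : ∀ ζ, (p ζ : ℂ) = superSymbol μ κp y ζ)
    (hbm : Measurable b) (hpm : Measurable p) (hχm : Measurable χ)
    (hb1 : ∀ ζ, |b ζ| ≤ 1) (hp1 : ∀ ζ, |p ζ| ≤ 1) (hχ1 : ∀ ζ, |χ ζ| ≤ 1)
    (hχ : ∀ ζ η, b ζ ≠ 0 → p η ≠ 0 → χ (ζ - η) = 1) (hχb : ∀ ζ, b ζ ≠ 0 → χ ζ = 1)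
    {F : Plane → ℂ} (hF : IntegrableL2 F) (hF0 : IntegrableL2 (freqDeriv 0 F))
    (hF1 : IntegrableL2 (freqDeriv 1 F)) (hreal : ∀ x, (𝓕⁻ F x).im = 0) {Γ : ℝ}
    (hΓ : ∀ x, ‖𝓕⁻ (freqDeriv 0 F) x‖ + ‖𝓕⁻ (freqDeriv 1 F) x‖ ≤ Γ) {θ : ℝ} (hθ : 0 < θ) :
    |(∫ ζ, inner ℂ ((b ζ : ℂ) ^ 2 * F ζ) (conv F (freqDeriv 0 F) ζ)).re| ≤
      Γ / 2 * ((∫ ζ, ‖(b ζ : ℂ) * F ζ‖ ^ 2) + ∫ ζ, ‖(1 - p ζ : ℂ) * F ζ‖ ^ 2)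
      + (∫ v, ‖κp v‖ ∂μ) * Γ / 2 * (∫ ζ, ‖(b ζ : ℂ) * F ζ‖ ^ 2)
      + (∫ v, ‖κp v‖ ∂μ) * Γ * (∫ v, ‖κ v‖ * ‖y v‖ ∂μ) / 2 *
        (θ * (∫ ζ, ‖(b ζ : ℂ) * F ζ‖ ^ 2) + θ⁻¹ * ∫ ζ, ‖(χ ζ : ℂ) * freqDeriv 0 F ζ‖ ^ 2) := by
  set W : Plane → ℂ := fun ζ => (b ζ : ℂ) * F ζ with hWdef
  set A : Plane → ℂ := fun ζ => (p ζ : ℂ) * F ζ with hAdef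
  set Q : Plane → ℂ := fun ζ => (1 - p ζ : ℂ) * F ζ with hQdef
  set G := freqDeriv 0 F with hGdef
  set G' : Plane → ℂ := fun ζ => (χ ζ : ℂ) * G ζ with hGdef'
  have hbs : AEStronglyMeasurable (fun ζ => (b ζ : ℂ)) (volume : Measure Plane) :=
    (Complex.measurable_ofReal.comp hbm).aestronglyMeasurable
  have hps : AEStronglyMeasurable (fun ζ => (p ζ : ℂ)) (volume : Measure Plane) :=
    (Complex.measurable_ofReal.comp hpm).aestronglyMeasurable
  have hχs : AEStronglyMeasurable (fun ζ => (χ ζ : ℂ)) (volume : Measure Plane) :=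
    (Complex.measurable_ofReal.comp hχm).aestronglyMeasurable
  have nb : ∀ ζ, ‖(b ζ : ℂ)‖ ≤ 1 := fun ζ => by simpa using hb1 ζ
  have np : ∀ ζ, ‖(p ζ : ℂ)‖ ≤ 1 := fun ζ => by simpa using hp1 ζ
  have nχ : ∀ ζ, ‖(χ ζ : ℂ)‖ ≤ 1 := fun ζ => by simpa using hχ1 ζ
  have hW : IntegrableL2 W := hF.bdd_mul hbs 1 nb
  have hA : IntegrableL2 A := hF.bdd_mul hps 1 np
  have hQ : IntegrableL2 Q := by
    have := hF.sub hA
    refine (congrArg IntegrableL2 (funext fun ζ => ?_)).mp this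
    simp only [hAdef, hQdef]; ring
  have hG' : IntegrableL2 G' := hF0.bdd_mul hχs 1 nχ
  have hW0e : freqDeriv 0 W = fun ζ => (b ζ : ℂ) * G ζ := freqDeriv_mul 0 _ F
  have hA0e : freqDeriv 0 A = fun ζ => (p ζ : ℂ) * G ζ := freqDeriv_mul 0 _ F
  have hW0 : IntegrableL2 (freqDeriv 0 W) := by rw [hW0e]; exact hF0.bdd_mul hbs 1 nb
  have hA0 : IntegrableL2 (freqDeriv 0 A) := by rw [hA0e]; exact hF0.bdd_mul hps 1 np
  have hB : IntegrableL2 (fun ζ => (b ζ : ℂ) * W ζ) := hW.bdd_mul hbs 1 nb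
  have hms : AEStronglyMeasurable (superSymbol μ κ y) := by
    have : superSymbol μ κ y = fun ζ => (b ζ : ℂ) := funext fun ζ => (hb ζ).symm
    rwa [this]
  have hmG := hG'.bdd_mul hms _ (norm_superSymbol_le κ y)
  have hcom := ((hA.convolution hG').bdd_mul hms _ (norm_superSymbol_le κ y)).sub
    (hA.convolution hmG)
  have hΓ0 : 0 ≤ Γ := (by positivity : (0 : ℝ) ≤ _).trans (hΓ 0)
  have hAp : A = fun ζ => superSymbol μ κp y ζ * F ζ := by
    ext ζ; rw [← hp]
  have hA0p : freqDeriv 0 A = fun ζ => superSymbol μ κp y ζ * G ζ := by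
    rw [hA0e]; ext ζ; rw [← hp]
  -- The three pieces are the high-frequency factor `Q`, the commutator of `b(D)` with `A`, and
  -- transport of `W = b F` by `A`. Replacing `G` by `G' = χ G` changes nothing, by the support
  -- conditions `hχ` and `hχb`, and leaves only frequencies near the annulus in the commutator.
  have hpt : ∀ ζ, inner ℂ ((b ζ : ℂ) ^ 2 * F ζ) (conv F G ζ)
      = inner ℂ ((b ζ : ℂ) * W ζ) (conv Q G ζ)
        + inner ℂ (W ζ) (superSymbol μ κ y ζ * conv A G' ζ
          - conv A (fun ζ => superSymbol μ κ y ζ * G' ζ) ζ)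
        + inner ℂ (W ζ) (conv A (freqDeriv 0 W) ζ) := by
    intro ζ
    have h1 : conv F G ζ = conv A G ζ + conv Q G ζ := by
      simp only [conv]
      rw [← integral_add (hA.integrable_mul_comp_sub hF0 ζ) (hQ.integrable_mul_comp_sub hF0 ζ)]
      congr 1; ext t
      simp only [hAdef, hQdef]; ring
    have h2 : (b ζ : ℂ) * conv A G ζ = b ζ * conv A G' ζ := by
      by_cases hb0 : b ζ = 0
      · simp [hb0]
      · congr 1
        simp only [conv]
        congr 1; ext t
        by_cases hp0 : p t = 0
        · simp [hAdef, hp0]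
        · simp [hGdef', hχ ζ t hb0 hp0]
    have h3 : freqDeriv 0 W = fun ζ => superSymbol μ κ y ζ * G' ζ := by
      rw [hW0e]; ext η
      rw [← hb]
      by_cases hb0 : b η = 0
      · simp [hb0]
      · simp [hGdef', hχb η hb0]
    rw [← h3, ← hb, ← h2, h1]
    simp only [RCLike.inner_apply, hWdef, map_mul, map_pow, Complex.conj_ofReal]
    ring
  have i1 := hB.inner_integrable (hQ.convolution hF0)
  have i2 := hW.inner_integrable hcom
  have i3 := hW.inner_integrable (hA.convolution hW0)
  have i12 : Integrable (fun ζ => inner ℂ ((b ζ : ℂ) * W ζ) (conv Q G ζ)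
      + inner ℂ (W ζ) (superSymbol μ κ y ζ * conv A G' ζ
        - conv A (fun ζ => superSymbol μ κ y ζ * G' ζ) ζ)) := i1.add i2
  simp_rw [hpt]
  rw [integral_add i12 i3, integral_add i1 i2]
  have t1 : ‖∫ ζ, inner ℂ ((b ζ : ℂ) * W ζ) (conv Q G ζ)‖
      ≤ Γ / 2 * ((∫ ζ, ‖W ζ‖ ^ 2) + ∫ ζ, ‖Q ζ‖ ^ 2) := by
    rw [← hB.integral_inner_fourierInv (hQ.convolution hF0)]
    have hle : ∫ x, ‖𝓕⁻ (fun ζ => (b ζ : ℂ) * W ζ) x‖ ^ 2 ≤ ∫ ζ, ‖W ζ‖ ^ 2 := by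
      rw [hB.integral_norm_sq_fourierInv]
      refine integral_mono hB.integrable_norm_sq hW.integrable_norm_sq fun ζ => ?_
      simp only
      rw [norm_mul]
      gcongr
      exact mul_le_of_le_one_left (norm_nonneg _) (nb ζ)
    calc _ ≤ ∫ x, Γ / 2 * (‖𝓕⁻ (fun ζ => (b ζ : ℂ) * W ζ) x‖ ^ 2 + ‖𝓕⁻ Q x‖ ^ 2) := by
          refine norm_integral_le_of_norm_le
            ((hB.integrable_norm_sq_fourierInv.add hQ.integrable_norm_sq_fourierInv).const_mul _)
            (ae_of_all _ fun x => ?_)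
          refine (norm_inner_le_norm _ _).trans ?_
          rw [fourierInv_conv hQ.1 hF0.1, norm_mul]
          have hg : ‖𝓕⁻ G x‖ ≤ Γ := le_trans (le_add_of_nonneg_right (norm_nonneg _)) (hΓ x)
          set w := ‖𝓕⁻ (fun ζ => (b ζ : ℂ) * W ζ) x‖
          set q := ‖𝓕⁻ Q x‖
          have hwq : 0 ≤ w * q := by positivity
          nlinarith [mul_nonneg hΓ0 (sq_nonneg (w - q)), mul_le_mul_of_nonneg_left hg hwq]
      _ = Γ / 2 * ((∫ x, ‖𝓕⁻ (fun ζ => (b ζ : ℂ) * W ζ) x‖ ^ 2) + ∫ ζ, ‖Q ζ‖ ^ 2) := by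
          rw [integral_const_mul, integral_add hB.integrable_norm_sq_fourierInv
            hQ.integrable_norm_sq_fourierInv, hQ.integral_norm_sq_fourierInv]
      _ ≤ _ := by gcongr
  have hL : ∀ x z, ‖𝓕⁻ A (x + z) - 𝓕⁻ A x‖ ≤ (∫ v, ‖κp v‖ ∂μ) * Γ * ‖z‖ := by
    rw [hAp]
    exact norm_fourierInv_superSymbol_mul_sub_le hκp hy hF.1
      (norm_fourierInv_sub_le hF.1 hF0.1 hF1.1 hΓ)
  have hκp0 : 0 ≤ ∫ v, ‖κp v‖ ∂μ := by positivity
  have t2 := norm_integral_commutator_le hκ hy hκy hms hA hG' hW (mul_nonneg hκp0 hΓ0) hL hθ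
  have t3 := hA.abs_re_integral_transport_le hA0 hW hW0
    (by rw [hAp]; exact im_fourierInv_superSymbol_mul hκp hy hκr hF.1 hreal)
    (M := (∫ v, ‖κp v‖ ∂μ) * Γ)
    (by
      rw [hA0p]
      exact norm_fourierInv_superSymbol_mul_le hκp hy hF0.1
        (fun x => le_trans (le_add_of_nonneg_right (norm_nonneg _)) (hΓ x)))
  have s1 := (Complex.abs_re_le_norm _).trans t1
  have s2 := (Complex.abs_re_le_norm _).trans t2
  rw [Complex.add_re, Complex.add_re]
  refine (abs_add_three _ _ _).trans ?_
  linarith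

end Superposition

/-! ### The bracket and kernels of dilated radial symbols -/

/-- Three-dimensional space: the frequency plane with an extra variable, which carries the
inhomogeneity of the bracket `⟨ζ⟩`. -/
abbrev Space : Type := EuclideanSpace ℝ (Fin 3)

/-- The Japanese bracket `⟨2πζ⟩` of the angular frequency. -/
def bracket (ζ : Plane) : ℝ := Real.sqrt (1 + ‖(2 * Real.pi) • ζ‖ ^ 2)

theorem bracket_sq (ζ : Plane) : bracket ζ ^ 2 = 1 + ‖(2 * Real.pi) • ζ‖ ^ 2 :=
  Real.sq_sqrt (by positivity)

theorem one_le_bracket (ζ : Plane) : 1 ≤ bracket ζ :=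
  Real.one_le_sqrt.2 (by linarith [sq_nonneg ‖(2 * Real.pi) • ζ‖])

theorem bracket_pos (ζ : Plane) : 0 < bracket ζ := one_pos.trans_le (one_le_bracket ζ)

theorem norm_le_bracket (ζ : Plane) : ‖(2 * Real.pi) • ζ‖ ≤ bracket ζ :=
  Real.le_sqrt_of_sq_le (by linarith)

theorem continuous_bracket : Continuous bracket := by unfold bracket; fun_prop

theorem abs_coord_le_bracket (j : Fin 2) (ζ : Plane) : |2 * Real.pi * ζ j| ≤ bracket ζ := by
  refine le_trans ?_ (norm_le_bracket ζ)
  simpa using PiLp.norm_apply_le ((2 * Real.pi) • ζ) j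

/-- The bracket is the Euclidean norm of `(2πζ, 1)`, so this is the reverse triangle inequality. -/
theorem bracket_sub_le (ζ η : Plane) :
    |bracket (ζ - η) - bracket ζ| ≤ ‖(2 * Real.pi) • η‖ := by
  have h1 : ∀ ζ : Plane, bracket ζ = ‖WithLp.toLp 2 ((2 * Real.pi) • ζ, (1 : ℝ))‖ := fun ζ => by
    rw [WithLp.prod_norm_eq_of_L2, bracket]
    simp [add_comm]
  rw [h1, h1]
  refine (abs_norm_sub_norm_le _ _).trans (le_of_eq ?_)
  rw [← WithLp.toLp_sub, WithLp.prod_norm_eq_of_L2, Prod.mk_sub_mk]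
  simp [smul_sub, Real.sqrt_sq]

/-- The embedding of the angular frequency plane at height `e`. -/
def lift (e : ℝ) (ζ : Plane) : Space := !₂[2 * Real.pi * ζ 0, 2 * Real.pi * ζ 1, e]

theorem norm_lift_sq (e : ℝ) (ζ : Plane) :
    ‖lift e ζ‖ ^ 2 = ‖(2 * Real.pi) • ζ‖ ^ 2 + e ^ 2 := by
  rw [EuclideanSpace.norm_sq_eq, EuclideanSpace.norm_sq_eq, Fin.sum_univ_three, Fin.sum_univ_two]
  simp [lift]

section Radial

variable {c : ℝ} (φ : ContDiffBump c)

/-- A radial bump function in space. -/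
def radialBump : 𝓢(Space, ℂ) :=
  HasCompactSupport.toSchwartzMap (f := fun w : Space => ((φ (‖w‖ ^ 2) : ℝ) : ℂ))
    (by
      refine HasCompactSupport.of_support_subset_isCompact
        (isCompact_closedBall (0 : Space) (|c| + φ.rOut + 1)) fun w hw => ?_
      have h1 : φ (‖w‖ ^ 2) ≠ 0 := fun h => hw (by simp [h])
      have h2 : ‖w‖ ^ 2 ∈ Metric.ball c φ.rOut := by
        rw [← φ.support_eq]; exact h1
      rw [Metric.mem_ball, Real.dist_eq] at h2
      rw [mem_closedBall_zero_iff]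
      have h3 := (abs_lt.1 h2).2
      nlinarith [le_abs_self c, sq_nonneg (‖w‖ - 1), norm_nonneg w, φ.rOut_pos])
    (Complex.ofRealCLM.contDiff.comp (φ.contDiff.comp (contDiff_norm_sq ℝ)))

theorem radialBump_apply (w : Space) : radialBump φ w = ((φ (‖w‖ ^ 2) : ℝ) : ℂ) := rfl

/-- The convolution kernel of a radial bump function. -/
def radialKernel : 𝓢(Space, ℂ) := 𝓕 (radialBump φ)

theorem radialBump_eq_integral (w : Space) :
    radialBump φ w = ∫ v, radialKernel φ v * (Real.fourierChar (inner ℝ v w) : ℂ) := by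
  have h : 𝓕⁻ (radialKernel φ) = radialBump φ := by simp [radialKernel]
  rw [← h, SchwartzMap.fourierInv_coe, Real.fourierInv_eq]
  congr 1; ext v
  rw [Circle.smul_def, smul_eq_mul, mul_comm]

/-- The bump is real and even. -/
theorem im_radialKernel (v : Space) : (radialKernel φ v).im = 0 := by
  rw [← Complex.conj_eq_iff_im]
  have h1 : radialKernel φ v = 𝓕 (radialBump φ : Space → ℂ) v := by
    rw [radialKernel, SchwartzMap.fourier_coe]
  have h2 : 𝓕⁻ (radialBump φ : Space → ℂ) = 𝓕 (radialBump φ : Space → ℂ) := by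
    rw [Real.fourierInv_eq_fourier_comp_neg]
    congr 1; ext w
    simp [radialBump_apply]
  rw [h1]
  conv_rhs => rw [← h2]
  rw [Real.fourier_eq, Real.fourierInv_eq, ← integral_conj]
  congr 1; ext w
  rw [Circle.smul_def, Circle.smul_def, smul_eq_mul, smul_eq_mul, map_mul, radialBump_apply,
    Complex.conj_ofReal, AddChar.map_neg_eq_inv, Circle.coe_inv_eq_conj, Complex.conj_conj]

/-- The dilated radial symbol, at height `e`. -/
def dilatedSymbol (e l : ℝ) (ζ : Plane) : ℝ := φ ((‖(2 * Real.pi) • ζ‖ ^ 2 + e ^ 2) / l ^ 2)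

/-- The translation that belongs to a point of space. -/
def shift (l : ℝ) (v : Space) : Plane := (2 * Real.pi / l) • !₂[v 0, v 1]

/-- The kernel of the dilated symbol. -/
def dilatedKernel (e l : ℝ) (v : Space) : ℂ :=
  radialKernel φ v * (Real.fourierChar (v 2 * e / l) : ℂ)

theorem measurable_shift (l : ℝ) : Measurable (shift l) := by
  have : Continuous (shift l) := by
    have h : Continuous fun v : Space => (![v 0, v 1] : Fin 2 → ℝ) := by
      refine continuous_pi fun i => ?_
      fin_cases i <;> simp <;> fun_prop
    exact ((PiLp.continuous_toLp 2 (fun _ : Fin 2 => ℝ)).comp h).const_smul (2 * Real.pi / l)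
  exact this.measurable

theorem norm_shift_le {l : ℝ} (hl : 0 < l) (v : Space) :
    ‖shift l v‖ ≤ 2 * Real.pi / l * ‖v‖ := by
  rw [shift, norm_smul, Real.norm_of_nonneg (by positivity)]
  gcongr
  rw [EuclideanSpace.norm_eq, EuclideanSpace.norm_eq, Fin.sum_univ_three, Fin.sum_univ_two]
  apply Real.sqrt_le_sqrt
  simp
  positivity

theorem norm_dilatedKernel (e l : ℝ) (v : Space) :
    ‖dilatedKernel φ e l v‖ = ‖radialKernel φ v‖ := by
  rw [dilatedKernel, norm_mul, Circle.norm_coe, mul_one]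

theorem measurable_dilatedKernel (e l : ℝ) : Measurable (dilatedKernel φ e l) := by
  have h : Continuous fun v : Space => (Real.fourierChar (v 2 * e / l) : ℂ) :=
    continuous_subtype_val.comp (Real.continuous_fourierChar.comp (by fun_prop))
  exact ((radialKernel φ).continuous.mul h).measurable

theorem integrable_dilatedKernel (e l : ℝ) : Integrable (dilatedKernel φ e l) :=
  (radialKernel φ).integrable.mono (measurable_dilatedKernel φ e l).aestronglyMeasurable
    (ae_of_all _ fun v => (norm_dilatedKernel φ e l v).le)

theorem integrable_norm_mul_radialKernel :
    Integrable (fun v : Space => ‖radialKernel φ v‖ * ‖v‖) := by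
  have := (radialKernel φ).integrable_pow_mul volume 1
  simpa [mul_comm] using this

theorem integrable_dilatedKernel_mul_shift {l : ℝ} (hl : 0 < l) (e : ℝ) :
    Integrable (fun v => ‖dilatedKernel φ e l v‖ * ‖shift l v‖) := by
  refine ((integrable_norm_mul_radialKernel φ).const_mul (2 * Real.pi / l)).mono'
    ((measurable_dilatedKernel φ e l).norm.mul (measurable_shift l).norm).aestronglyMeasurable
    (ae_of_all _ fun v => ?_)
  rw [Real.norm_of_nonneg (by positivity), norm_dilatedKernel]
  calc _ ≤ ‖radialKernel φ v‖ * (2 * Real.pi / l * ‖v‖) := by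
        gcongr; exact norm_shift_le hl v
    _ = _ := by ring

theorem integral_dilatedKernel_mul_shift_le {l : ℝ} (hl : 0 < l) (e : ℝ) :
    ∫ v, ‖dilatedKernel φ e l v‖ * ‖shift l v‖
      ≤ 2 * Real.pi / l * ∫ v, ‖radialKernel φ v‖ * ‖v‖ := by
  rw [← integral_const_mul]
  refine integral_mono (integrable_dilatedKernel_mul_shift φ hl e)
    ((integrable_norm_mul_radialKernel φ).const_mul _) fun v => ?_
  simp only
  rw [norm_dilatedKernel]
  calc _ ≤ ‖radialKernel φ v‖ * (2 * Real.pi / l * ‖v‖) := by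
        gcongr; exact norm_shift_le hl v
    _ = _ := by ring

/-- The symbol is the radial bump at the point `l⁻¹ • lift e ζ`, to which Fourier inversion in space
applies. In the inner product the first two coordinates of `v` give the translation `shift l v`. The
third gives a phase independent of `ζ`, which goes into the kernel without changing its modulus. -/
theorem dilatedSymbol_eq_superSymbol {l : ℝ} (e : ℝ) (ζ : Plane) :
    (dilatedSymbol φ e l ζ : ℂ) = superSymbol volume (dilatedKernel φ e l) (shift l) ζ := by
  have h1 : (dilatedSymbol φ e l ζ : ℂ) = radialBump φ (l⁻¹ • lift e ζ) := by
    rw [radialBump_apply, norm_smul, mul_pow, norm_lift_sq, dilatedSymbol, norm_inv, inv_pow,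
      Real.norm_eq_abs, sq_abs, div_eq_inv_mul]
  rw [h1, radialBump_eq_integral, superSymbol]
  congr 1; ext v
  rw [dilatedKernel, mul_assoc, ← Circle.coe_mul, ← AddChar.map_add_eq_mul]
  congr 4
  rw [PiLp.inner_apply, PiLp.inner_apply, Fin.sum_univ_three, Fin.sum_univ_two]
  simp [lift, shift]
  ring

theorem measurable_dilatedSymbol (e l : ℝ) : Measurable (dilatedSymbol φ e l) := by
  have : Continuous (dilatedSymbol φ e l) := φ.continuous.comp (by fun_prop)
  exact this.measurable

theorem abs_dilatedSymbol_le (e l : ℝ) (ζ : Plane) : |dilatedSymbol φ e l ζ| ≤ 1 := by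
  rw [dilatedSymbol, abs_of_nonneg φ.nonneg]; exact φ.le_one

theorem dilatedSymbol_nonneg (e l : ℝ) (ζ : Plane) : 0 ≤ dilatedSymbol φ e l ζ := φ.nonneg

end Radial

/-! ### The energy estimate at a single scale -/

/-- The profile of the annular localisation. -/
def annulusBump : ContDiffBump (5 / 2 : ℝ) := ⟨1, 3 / 2, by norm_num, by norm_num⟩

/-- The profile of the low frequency localisation. -/
def ballBump : ContDiffBump (0 : ℝ) := ⟨1 / 64, 1 / 16, by norm_num, by norm_num⟩

/-- The symbol of the localisation to `l < ⟨ζ⟩ < 2 l`. -/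
def annulus (l : ℝ) (ζ : Plane) : ℝ := dilatedSymbol annulusBump 1 l ζ

/-- The symbol of the localisation to `|ζ| < l / 4`. -/
def lowPass (l : ℝ) (ζ : Plane) : ℝ := dilatedSymbol ballBump 0 l ζ

theorem annulus_eq (l : ℝ) (ζ : Plane) : annulus l ζ = annulusBump ((bracket ζ / l) ^ 2) := by
  rw [annulus, dilatedSymbol, div_pow, bracket_sq, one_pow, add_comm]

/-- The profile is supported where `|(⟨ζ⟩/l)² - 5/2| < 3/2`, that is `1 < (⟨ζ⟩/l)² < 4`. -/
theorem of_annulus_ne_zero {l : ℝ} (hl : 0 < l) {ζ : Plane} (h : annulus l ζ ≠ 0) :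
    l < bracket ζ ∧ bracket ζ < 2 * l := by
  rw [annulus_eq] at h
  have h2 : (bracket ζ / l) ^ 2 ∈ Metric.ball (5 / 2 : ℝ) annulusBump.rOut := by
    rw [← annulusBump.support_eq]; exact h
  rw [Metric.mem_ball, Real.dist_eq] at h2
  have e : annulusBump.rOut = 3 / 2 := rfl
  rw [e, abs_lt] at h2
  have hb := bracket_pos ζ
  have h3 : 0 < bracket ζ / l := by positivity
  have h4 : 1 < bracket ζ / l := by nlinarith
  have h5 : bracket ζ / l < 2 := by nlinarith
  exact ⟨(one_lt_div hl).1 h4, (div_lt_iff₀ hl).1 h5⟩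

theorem of_lowPass_ne_zero {l : ℝ} (hl : 0 < l) {ζ : Plane} (h : lowPass l ζ ≠ 0) :
    ‖(2 * Real.pi) • ζ‖ < l / 4 := by
  have h2 : (‖(2 * Real.pi) • ζ‖ ^ 2 + 0 ^ 2) / l ^ 2 ∈ Metric.ball (0 : ℝ) ballBump.rOut := by
    rw [← ballBump.support_eq]; exact h
  rw [Metric.mem_ball, Real.dist_eq] at h2
  have e : ballBump.rOut = 1 / 16 := rfl
  rw [e, sub_zero, abs_lt, div_lt_iff₀ (by positivity)] at h2
  refine lt_of_pow_lt_pow_left₀ 2 (by positivity) ?_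
  nlinarith [h2.2]

theorem lowPass_eq_one {l : ℝ} (hl : 0 < l) {ζ : Plane} (h : ‖(2 * Real.pi) • ζ‖ ≤ l / 8) :
    lowPass l ζ = 1 := by
  apply ballBump.one_of_mem_closedBall
  have e : ballBump.rIn = 1 / 64 := rfl
  rw [mem_closedBall_zero_iff, Real.norm_of_nonneg (by positivity), e,
    div_le_iff₀ (by positivity)]
  nlinarith [norm_nonneg ((2 * Real.pi) • ζ)]

/-- The part of the mass of `F` at frequencies at least comparable to `l`. -/
def tailMass (F : Plane → ℂ) (l : ℝ) : ℝ :=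
  ∫ ζ, Set.indicator {ζ | l ≤ 8 * bracket ζ} (fun ζ => ‖F ζ‖ ^ 2) ζ

theorem measurableSet_tail (l : ℝ) : MeasurableSet {ζ : Plane | l ≤ 8 * bracket ζ} :=
  measurableSet_le measurable_const (continuous_bracket.measurable.const_mul 8)

theorem integral_norm_sq_le_tailMass {F H : Plane → ℂ} (hF : IntegrableL2 F) {l C : ℝ}
    (h0 : ∀ ζ, H ζ ≠ 0 → l ≤ 8 * bracket ζ) (h : ∀ ζ, ‖H ζ‖ ≤ C * ‖F ζ‖) :
    ∫ ζ, ‖H ζ‖ ^ 2 ≤ C ^ 2 * tailMass F l := by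
  rw [tailMass, ← integral_const_mul]
  refine integral_mono_of_nonneg (ae_of_all _ fun ζ => by positivity)
    ((hF.integrable_norm_sq.indicator (measurableSet_tail l)).const_mul _)
    (ae_of_all _ fun ζ => ?_)
  simp only
  by_cases hζ : l ≤ 8 * bracket ζ
  · rw [Set.indicator_of_mem (by exact hζ), ← mul_pow]
    gcongr
    exact h ζ
  · have : H ζ = 0 := by
      by_contra hne; exact hζ (h0 ζ hne)
    rw [this, Set.indicator_of_notMem (by exact hζ)]
    simp

/-- The constant is independent of `l`: the kernel masses do not change under dilation, and the
factor `1/l` in the first moment cancels the size `l` of the derivative on the annulus. -/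
theorem exists_localized_bound : ∃ K : ℝ, 0 < K ∧ ∀ (l : ℝ), 0 < l →
    ∀ (F : Plane → ℂ), IntegrableL2 F → IntegrableL2 (freqDeriv 0 F) →
    IntegrableL2 (freqDeriv 1 F) → (∀ x, (𝓕⁻ F x).im = 0) → ∀ (Γ : ℝ),
    (∀ x, ‖𝓕⁻ (freqDeriv 0 F) x‖ + ‖𝓕⁻ (freqDeriv 1 F) x‖ ≤ Γ) →
    |(∫ ζ, inner ℂ ((annulus l ζ : ℂ) ^ 2 * F ζ) (conv F (freqDeriv 0 F) ζ)).re| ≤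
      K * Γ * tailMass F l := by
  set Kp := ∫ v, ‖radialKernel ballBump v‖ with hKp
  set Kb := ∫ v, ‖radialKernel annulusBump v‖ * ‖v‖ with hKb
  have hKp0 : 0 ≤ Kp := by positivity
  have hKb0 : 0 ≤ Kb := by positivity
  -- The summands come from the high-frequency factor, the transport term and the commutator, in
  -- this order.
  refine ⟨1 + Kp / 2 + Kp * (2 * Real.pi * Kb) / 2 * (1 + (9 / 4) ^ 2), by positivity, ?_⟩
  intro l hl F hF hF0 hF1 hreal Γ hΓ
  have hΓ0 : 0 ≤ Γ := (by positivity : (0 : ℝ) ≤ _).trans (hΓ 0)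
  -- The annulus `l < ⟨ζ⟩ < 2l` widened by `l/4`, the radius of the low-pass ball, on both sides.
  set S : Set Plane := {ζ | 3 / 4 * l ≤ bracket ζ ∧ bracket ζ ≤ 9 / 4 * l} with hS
  have hSm : MeasurableSet S :=
    (measurableSet_le measurable_const continuous_bracket.measurable).inter
      (measurableSet_le continuous_bracket.measurable measurable_const)
  set χ : Plane → ℝ := S.indicator 1 with hχ
  have key := abs_re_integral_localized_le (μ := (volume : Measure Space)) (b := annulus l)
    (p := lowPass l) (χ := χ)
    (integrable_dilatedKernel annulusBump 1 l) (integrable_dilatedKernel ballBump 0 l)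
    (measurable_shift l) (integrable_dilatedKernel_mul_shift annulusBump hl 1)
    (fun v => by simp [dilatedKernel, im_radialKernel])
    (dilatedSymbol_eq_superSymbol annulusBump 1) (dilatedSymbol_eq_superSymbol ballBump 0)
    (measurable_dilatedSymbol _ _ _) (measurable_dilatedSymbol _ _ _)
    (measurable_one.indicator hSm) (abs_dilatedSymbol_le _ _ _) (abs_dilatedSymbol_le _ _ _)
    (fun ζ => by by_cases h : ζ ∈ S <;> simp [hχ, h])
    (fun ζ η h1 h2 => by
      have a := of_annulus_ne_zero hl h1
      have b := of_lowPass_ne_zero hl h2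
      have d := abs_le.1 (bracket_sub_le ζ η)
      have : ζ - η ∈ S := ⟨by linarith [d.1], by linarith [d.2]⟩
      simp [hχ, this])
    (fun ζ h1 => by
      have a := of_annulus_ne_zero hl h1
      have : ζ ∈ S := ⟨by linarith, by linarith⟩
      simp [hχ, this])
    -- The last argument chooses `θ = l`, the size of the derivative on the annulus.
    hF hF0 hF1 hreal hΓ hl
  have m1 : ∫ ζ, ‖(annulus l ζ : ℂ) * F ζ‖ ^ 2 ≤ 1 ^ 2 * tailMass F l := by
    refine integral_norm_sq_le_tailMass hF (fun ζ h => ?_) fun ζ => ?_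
    · have h' : annulus l ζ ≠ 0 := fun h0 => h (by simp [h0])
      linarith [(of_annulus_ne_zero hl h').1]
    · rw [norm_mul]
      gcongr
      rw [Complex.norm_real]
      exact abs_dilatedSymbol_le annulusBump 1 l ζ
  have m2 : ∫ ζ, ‖(1 - lowPass l ζ : ℂ) * F ζ‖ ^ 2 ≤ 1 ^ 2 * tailMass F l := by
    refine integral_norm_sq_le_tailMass hF (fun ζ h => ?_) fun ζ => ?_
    · by_contra hlt
      refine h ?_
      rw [lowPass_eq_one hl (by linarith [norm_le_bracket ζ])]
      simp
    · rw [norm_mul]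
      gcongr
      rw [← Complex.ofReal_one, ← Complex.ofReal_sub, Complex.norm_real, Real.norm_eq_abs, abs_le]
      have a1 := (abs_le.1 (abs_dilatedSymbol_le ballBump 0 l ζ)).2
      have a2 := dilatedSymbol_nonneg ballBump 0 l ζ
      constructor <;> (rw [lowPass]; linarith)
  have m3 : ∫ ζ, ‖(χ ζ : ℂ) * freqDeriv 0 F ζ‖ ^ 2 ≤ (9 / 4 * l) ^ 2 * tailMass F l := by
    refine integral_norm_sq_le_tailMass hF (fun ζ h => ?_) fun ζ => ?_
    · have : ζ ∈ S := by
        by_contra hn; exact h (by simp [hχ, hn])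
      linarith [this.1]
    · by_cases hζ : ζ ∈ S
      · simp only [hχ, Set.indicator_of_mem hζ, Pi.one_apply, Complex.ofReal_one, one_mul,
          freqDeriv, norm_mul, Complex.norm_I, Complex.norm_real]
        rw [← norm_mul, ← norm_mul]
        gcongr
        exact (abs_coord_le_bracket 0 ζ).trans hζ.2
      · simp only [hχ, Set.indicator_of_notMem hζ]
        simp
        positivity
  have k1 : ∫ v, ‖dilatedKernel ballBump 0 l v‖ = Kp := by
    simp_rw [norm_dilatedKernel, hKp]
  have k2 := integral_dilatedKernel_mul_shift_le annulusBump hl 1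
  rw [k1] at key
  set N := tailMass F l with hN
  have hN0 : 0 ≤ N := integral_nonneg fun ζ => Set.indicator_nonneg (fun _ _ => by positivity) ζ
  refine key.trans ?_
  calc _ ≤ Γ / 2 * (1 ^ 2 * N + 1 ^ 2 * N) + Kp * Γ / 2 * (1 ^ 2 * N)
        + Kp * Γ * (2 * Real.pi / l * Kb) / 2
          * (l * (1 ^ 2 * N) + l⁻¹ * ((9 / 4 * l) ^ 2 * N)) := by
        gcongr
    _ = _ := by field_simp; ring

/-! ### The Sobolev weight as an integral over scales -/

/-- The truncation at frequency `R` of (a multiple of) the weight `⟨ζ⟩ ^ (2 s)`. -/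
def weight (s R : ℝ) (ζ : Plane) : ℝ := ∫ l in Set.Ioc 0 R, l ^ (2 * s - 1) * annulus l ζ ^ 2

/-- The multiple of `⟨ζ⟩ ^ (2 s)` that is approximated by `weight s R`. -/
def weightConst (s : ℝ) : ℝ :=
  ∫ l in Set.Ioi (0 : ℝ), l ^ (2 * s - 1) * annulusBump ((1 / l) ^ 2) ^ 2

variable {s : ℝ}

theorem integrableOn_rpow_Ioc (hs : 0 < s) {R : ℝ} (hR : 0 ≤ R) :
    IntegrableOn (fun l : ℝ => l ^ (2 * s - 1)) (Set.Ioc 0 R) :=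
  (intervalIntegrable_iff_integrableOn_Ioc_of_le hR).1
    (intervalIntegral.intervalIntegrable_rpow' (by linarith))

theorem integral_rpow_Ioc (hs : 0 < s) {R : ℝ} (hR : 0 ≤ R) :
    ∫ l in Set.Ioc 0 R, l ^ (2 * s - 1) = R ^ (2 * s) / (2 * s) := by
  rw [← intervalIntegral.integral_of_le hR, integral_rpow (Or.inl (by linarith))]
  rw [sub_add_cancel, Real.zero_rpow (by positivity), sub_zero]

theorem measurable_annulusBump_div :
    Measurable (fun q : ℝ × ℝ => annulusBump ((q.2 / q.1) ^ 2)) :=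
  annulusBump.continuous.measurable.comp (by fun_prop)

theorem measurable_annulus : Measurable (fun q : ℝ × Plane => annulus q.1 q.2) := by
  simp_rw [annulus_eq]
  exact measurable_annulusBump_div.comp
    (measurable_fst.prodMk (continuous_bracket.measurable.comp measurable_snd))

theorem annulusBump_eq_zero {w l : ℝ} (hw : 0 < w) (hl : w < l) :
    annulusBump ((w / l) ^ 2) = 0 := by
  by_contra h
  have h2 : (w / l) ^ 2 ∈ Metric.ball (5 / 2 : ℝ) annulusBump.rOut := by
    rw [← annulusBump.support_eq]; exact h
  have e : annulusBump.rOut = 3 / 2 := rfl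
  rw [Metric.mem_ball, Real.dist_eq, e, abs_lt] at h2
  have h3 : w / l < 1 := (div_lt_one (hw.trans hl)).2 hl
  have h4 : 0 < w / l := div_pos hw (hw.trans hl)
  nlinarith [h2.1]

theorem integrableOn_weight_aux (hs : 0 < s) {w : ℝ} (hw : 0 < w) :
    IntegrableOn (fun l : ℝ => l ^ (2 * s - 1) * annulusBump ((w / l) ^ 2) ^ 2) (Set.Ioi 0) := by
  have hm : Measurable (fun l : ℝ => l ^ (2 * s - 1) * annulusBump ((w / l) ^ 2) ^ 2) :=
    (measurable_id.pow_const _).mul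
      ((measurable_annulusBump_div.comp (measurable_id.prodMk measurable_const)).pow_const 2)
  have h1 : IntegrableOn (fun l : ℝ => l ^ (2 * s - 1) * annulusBump ((w / l) ^ 2) ^ 2)
      (Set.Ioc 0 w) := by
    refine Integrable.mono' (integrableOn_rpow_Ioc hs hw.le) hm.aestronglyMeasurable ?_
    filter_upwards [ae_restrict_mem measurableSet_Ioc] with l hl
    have hl0 : 0 < l := hl.1
    rw [Real.norm_of_nonneg (by positivity)]
    have h0 : 0 ≤ annulusBump ((w / l) ^ 2) := annulusBump.nonneg
    have h1 : annulusBump ((w / l) ^ 2) ≤ 1 := annulusBump.le_one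
    exact mul_le_of_le_one_right (by positivity) (pow_le_one₀ h0 h1)
  have h2 : IntegrableOn (fun l : ℝ => l ^ (2 * s - 1) * annulusBump ((w / l) ^ 2) ^ 2)
      (Set.Ioi w) := by
    refine (integrable_zero ℝ ℝ _).congr ?_
    filter_upwards [ae_restrict_mem measurableSet_Ioi] with l hl
    rw [annulusBump_eq_zero hw hl]
    simp
  rw [← Set.Ioc_union_Ioi_eq_Ioi hw.le]
  exact h1.union h2

/-- Scaling: substitute `w * l` for `l`. -/
theorem integral_weight_aux {w : ℝ} (hw : 0 < w) :
    ∫ l in Set.Ioi (0 : ℝ), l ^ (2 * s - 1) * annulusBump ((w / l) ^ 2) ^ 2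
      = weightConst s * w ^ (2 * s) := by
  have h := integral_comp_mul_left_Ioi
    (fun l : ℝ => l ^ (2 * s - 1) * annulusBump ((w / l) ^ 2) ^ 2) 0 hw
  rw [mul_zero, smul_eq_mul] at h
  have h2 : ∫ l in Set.Ioi (0 : ℝ), (w * l) ^ (2 * s - 1) * annulusBump ((w / (w * l)) ^ 2) ^ 2
      = w ^ (2 * s - 1) * weightConst s := by
    rw [weightConst, ← integral_const_mul]
    refine setIntegral_congr_fun measurableSet_Ioi fun l hl => ?_
    have hl0 : (0 : ℝ) < l := hl
    rw [Real.mul_rpow hw.le hl0.le, div_mul_cancel_left₀ hw.ne', one_div]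
    ring
  rw [h2] at h
  have h3 : w ^ (2 * s) = w * w ^ (2 * s - 1) := by
    rw [Real.rpow_sub_one hw.ne']; field_simp
  rw [h3]
  calc _ = w * (w⁻¹ * ∫ l in Set.Ioi (0 : ℝ),
        l ^ (2 * s - 1) * annulusBump ((w / l) ^ 2) ^ 2) := by rw [mul_inv_cancel_left₀ hw.ne']
    _ = _ := by rw [← h]; ring

theorem weightConst_pos (hs : 0 < s) : 0 < weightConst s := by
  have hi := integrableOn_weight_aux hs one_pos
  rw [weightConst]
  refine (setIntegral_pos_iff_support_of_nonneg_ae ?_ hi).2 ?_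
  · filter_upwards [ae_restrict_mem measurableSet_Ioi] with l hl
    have hl0 : (0 : ℝ) < l := hl
    exact mul_nonneg (Real.rpow_nonneg hl0.le _) (sq_nonneg _)
  -- For these `l` one has `25/16 < 1/l² < 25/9`, inside the interval `[3/2, 7/2]` on which the
  -- profile equals `1`.
  · have hsub : Set.Ioo (3 / 5 : ℝ) (4 / 5) ⊆ Function.support
        (fun l : ℝ => l ^ (2 * s - 1) * annulusBump ((1 / l) ^ 2) ^ 2) ∩ Set.Ioi 0 := by
      intro l hl
      have hl0 : 0 < l := by linarith [hl.1]
      refine ⟨?_, hl0⟩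
      rw [Function.mem_support]
      have : annulusBump ((1 / l) ^ 2) = 1 := by
        apply annulusBump.one_of_mem_closedBall
        have e : annulusBump.rIn = 1 := rfl
        rw [Metric.mem_closedBall, Real.dist_eq, e, abs_le, div_pow, one_pow]
        constructor
        · rw [neg_le_sub_iff_le_add, ← sub_le_iff_le_add, le_div_iff₀ (by positivity)]
          nlinarith [hl.1, hl.2]
        · rw [sub_le_iff_le_add, div_le_iff₀ (by positivity)]
          nlinarith [hl.1, hl.2]
      rw [this]
      positivity
    refine lt_of_lt_of_le ?_ (measure_mono hsub)
    rw [Real.volume_Ioo]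
    norm_num

theorem weight_eq_aux (s R : ℝ) (ζ : Plane) :
    weight s R ζ = ∫ l in Set.Ioc 0 R, l ^ (2 * s - 1) * annulusBump ((bracket ζ / l) ^ 2) ^ 2 := by
  simp only [weight, annulus_eq]

theorem weight_nonneg (s R : ℝ) (ζ : Plane) : 0 ≤ weight s R ζ :=
  setIntegral_nonneg measurableSet_Ioc fun _ hl =>
    mul_nonneg (Real.rpow_nonneg hl.1.le _) (sq_nonneg _)

theorem weight_le (hs : 0 < s) (R : ℝ) (ζ : Plane) :
    weight s R ζ ≤ weightConst s * bracket ζ ^ (2 * s) := by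
  rw [← integral_weight_aux (bracket_pos ζ), weight_eq_aux]
  refine setIntegral_mono_set (integrableOn_weight_aux hs (bracket_pos ζ)) ?_
    (ae_of_all _ fun _ hl => hl.1)
  filter_upwards [ae_restrict_mem measurableSet_Ioi] with l hl
  have hl0 : (0 : ℝ) < l := hl
  exact mul_nonneg (Real.rpow_nonneg hl0.le _) (sq_nonneg _)

/-- Scales `l > R ≥ ⟨ζ⟩` do not see `ζ`, so the truncation loses nothing. -/
theorem weight_eq {R : ℝ} {ζ : Plane} (h : bracket ζ ≤ R) :
    weight s R ζ = weightConst s * bracket ζ ^ (2 * s) := by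
  rw [← integral_weight_aux (bracket_pos ζ), weight_eq_aux]
  symm
  refine setIntegral_eq_of_subset_of_forall_sdiff_eq_zero measurableSet_Ioi
    (fun _ hl => hl.1) fun l hl => ?_
  have hl0 : (0 : ℝ) < l := hl.1
  have : R < l := by
    by_contra hn
    exact hl.2 ⟨hl0, not_lt.1 hn⟩
  rw [annulusBump_eq_zero (bracket_pos ζ) (h.trans_lt this)]
  simp

/-- This makes the truncated weight a bounded multiplication operator on `L²`. -/
theorem weight_le_const (hs : 0 < s) {R : ℝ} (hR : 0 ≤ R) (ζ : Plane) :
    weight s R ζ ≤ R ^ (2 * s) / (2 * s) := by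
  rw [← integral_rpow_Ioc hs hR, weight_eq_aux]
  refine setIntegral_mono_on ((integrableOn_weight_aux hs (bracket_pos ζ)).mono_set
    fun l hl => hl.1) (integrableOn_rpow_Ioc hs hR) measurableSet_Ioc fun l hl => ?_
  have h0 : 0 ≤ annulusBump ((bracket ζ / l) ^ 2) := annulusBump.nonneg
  have h1 : annulusBump ((bracket ζ / l) ^ 2) ≤ 1 := annulusBump.le_one
  exact mul_le_of_le_one_right (Real.rpow_nonneg hl.1.le _) (pow_le_one₀ h0 h1)

theorem measurable_weight (s R : ℝ) : Measurable (weight s R) := by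
  have hm : Measurable (fun q : ℝ × Plane => q.1 ^ (2 * s - 1) * annulus q.1 q.2 ^ 2) :=
    (measurable_fst.pow_const _).mul (measurable_annulus.pow_const 2)
  exact (hm.stronglyMeasurable.integral_prod_left' (μ := volume.restrict (Set.Ioc 0 R))).measurable

/-- Integrate the single-scale bound against `l^{2s-1} dl` and exchange integrals. A frequency `ζ`
enters the tail mass only for `l ≤ 8⟨ζ⟩`, and these scales contribute at most `(8⟨ζ⟩)^{2s} / (2s)`,
which is uniform in `R`. -/
theorem exists_weighted_bound (hs : 0 < s) : ∃ K : ℝ, 0 < K ∧ ∀ (R : ℝ), 0 < R →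
    ∀ (F : Plane → ℂ), IntegrableL2 F → IntegrableL2 (freqDeriv 0 F) →
    IntegrableL2 (freqDeriv 1 F) → (∀ x, (𝓕⁻ F x).im = 0) →
    Integrable (fun ζ => bracket ζ ^ (2 * s) * ‖F ζ‖ ^ 2) → ∀ (Γ : ℝ),
    (∀ x, ‖𝓕⁻ (freqDeriv 0 F) x‖ + ‖𝓕⁻ (freqDeriv 1 F) x‖ ≤ Γ) →
    |(∫ ζ, inner ℂ ((weight s R ζ : ℂ) * F ζ) (conv F (freqDeriv 0 F) ζ)).re| ≤
      K * Γ * ∫ ζ, bracket ζ ^ (2 * s) * ‖F ζ‖ ^ 2 := by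
  obtain ⟨K, hK, hbound⟩ := exists_localized_bound
  refine ⟨K * (8 ^ (2 * s) / (2 * s)), by positivity, ?_⟩
  intro R hR F hF hF0 hF1 hreal hint Γ hΓ
  have hΓ0 : 0 ≤ Γ := (by positivity : (0 : ℝ) ≤ _).trans (hΓ 0)
  set μ := (volume : Measure ℝ).restrict (Set.Ioc 0 R) with hμ
  have hrp : Integrable (fun l : ℝ => l ^ (2 * s - 1)) μ := integrableOn_rpow_Ioc hs hR.le
  have hFH := hF.inner_integrable (hF.convolution hF0)
  have ham : Measurable (fun q : ℝ × Plane => ((annulus q.1 q.2 ^ 2 : ℝ) : ℂ)) :=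
    Complex.measurable_ofReal.comp (measurable_annulus.pow_const 2)
  have i1 : Integrable (fun q : ℝ × Plane => ((annulus q.1 q.2 ^ 2 : ℝ) : ℂ) *
      (((q.1 ^ (2 * s - 1) : ℝ) : ℂ) * inner ℂ (F q.2) (conv F (freqDeriv 0 F) q.2)))
      (μ.prod volume) := by
    refine (hrp.ofReal.mul_prod hFH).bdd_mul (c := 1) ham.aestronglyMeasurable
      (ae_of_all _ fun q => ?_)
    rw [Complex.norm_real, Real.norm_of_nonneg (by positivity), ← sq_abs]
    exact pow_le_one₀ (abs_nonneg _) (abs_dilatedSymbol_le _ _ _ _)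
  have hset : MeasurableSet {q : ℝ × Plane | q.1 ≤ 8 * bracket q.2} :=
    measurableSet_le measurable_fst
      ((continuous_bracket.measurable.comp measurable_snd).const_mul 8)
  have i2 : Integrable (fun q : ℝ × Plane => Set.indicator {q : ℝ × Plane | q.1 ≤ 8 * bracket q.2}
      (fun q => q.1 ^ (2 * s - 1) * ‖F q.2‖ ^ 2) q) (μ.prod volume) :=
    (hrp.mul_prod hF.integrable_norm_sq).indicator hset
  have e3 : ∀ l, ((l ^ (2 * s - 1) : ℝ) : ℂ) *
      (∫ ζ, inner ℂ ((annulus l ζ : ℂ) ^ 2 * F ζ) (conv F (freqDeriv 0 F) ζ))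
      = ∫ ζ, ((annulus l ζ ^ 2 : ℝ) : ℂ) *
        (((l ^ (2 * s - 1) : ℝ) : ℂ) * inner ℂ (F ζ) (conv F (freqDeriv 0 F) ζ)) := by
    intro l
    rw [← integral_const_mul]
    congr 1; ext ζ
    simp only [RCLike.inner_apply, map_mul, map_pow, Complex.conj_ofReal]
    push_cast; ring
  have i4 : Integrable (fun l => ((l ^ (2 * s - 1) : ℝ) : ℂ) *
      (∫ ζ, inner ℂ ((annulus l ζ : ℂ) ^ 2 * F ζ) (conv F (freqDeriv 0 F) ζ))) μ := by
    simp_rw [e3]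
    exact i1.integral_prod_left
  have e1 : ∫ ζ, inner ℂ ((weight s R ζ : ℂ) * F ζ) (conv F (freqDeriv 0 F) ζ)
      = ∫ l, ((l ^ (2 * s - 1) : ℝ) : ℂ) *
        (∫ ζ, inner ℂ ((annulus l ζ : ℂ) ^ 2 * F ζ) (conv F (freqDeriv 0 F) ζ)) ∂μ := by
    calc _ = ∫ ζ, ∫ l, ((annulus l ζ ^ 2 : ℝ) : ℂ) *
        (((l ^ (2 * s - 1) : ℝ) : ℂ) * inner ℂ (F ζ) (conv F (freqDeriv 0 F) ζ)) ∂μ ∂volume := by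
          congr 1; ext ζ
          simp_rw [← mul_assoc]
          rw [integral_mul_const, weight, ← integral_complex_ofReal]
          simp only [RCLike.inner_apply, map_mul, ← integral_conj, Complex.conj_ofReal]
          rw [mul_comm, mul_assoc, mul_comm _ (conv F _ ζ)]
          congr 2; ext l
          push_cast; ring
      _ = _ := by
          rw [← integral_integral_swap i1]
          simp_rw [e3]
  have e2 : ∀ l, (l ^ (2 * s - 1)) * tailMass F l
      = ∫ ζ, Set.indicator {q : ℝ × Plane | q.1 ≤ 8 * bracket q.2}
        (fun q => q.1 ^ (2 * s - 1) * ‖F q.2‖ ^ 2) (l, ζ) := by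
    intro l
    rw [tailMass, ← integral_const_mul]
    congr 1; ext ζ
    by_cases h : l ≤ 8 * bracket ζ <;> simp [Set.indicator, h]
  have i3 : Integrable (fun l => (l ^ (2 * s - 1)) * tailMass F l) μ := by
    simp_rw [e2]
    exact i2.integral_prod_left
  have h1 : |(∫ ζ, inner ℂ ((weight s R ζ : ℂ) * F ζ) (conv F (freqDeriv 0 F) ζ)).re|
      ≤ ∫ l, K * Γ * (l ^ (2 * s - 1) * tailMass F l) ∂μ := by
    rw [e1]
    have hre := integral_re i4
    have hre' : (∫ l, ((l ^ (2 * s - 1) : ℝ) : ℂ) *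
        (∫ ζ, inner ℂ ((annulus l ζ : ℂ) ^ 2 * F ζ) (conv F (freqDeriv 0 F) ζ)) ∂μ).re
        = ∫ l, (((l ^ (2 * s - 1) : ℝ) : ℂ) *
        (∫ ζ, inner ℂ ((annulus l ζ : ℂ) ^ 2 * F ζ) (conv F (freqDeriv 0 F) ζ))).re ∂μ :=
      hre.symm
    rw [hre', ← Real.norm_eq_abs]
    refine norm_integral_le_of_norm_le (i3.const_mul _) ?_
    filter_upwards [ae_restrict_mem measurableSet_Ioc] with l hl
    rw [Complex.re_ofReal_mul, norm_mul, Real.norm_of_nonneg (Real.rpow_nonneg hl.1.le _),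
      Real.norm_eq_abs]
    calc _ ≤ l ^ (2 * s - 1) * (K * Γ * tailMass F l) :=
          mul_le_mul_of_nonneg_left (hbound l hl.1 F hF hF0 hF1 hreal Γ hΓ)
            (Real.rpow_nonneg hl.1.le _)
      _ = _ := by ring
  have h2 : ∀ ζ, ∫ l, Set.indicator {q : ℝ × Plane | q.1 ≤ 8 * bracket q.2}
      (fun q => q.1 ^ (2 * s - 1) * ‖F q.2‖ ^ 2) (l, ζ) ∂μ
      ≤ 8 ^ (2 * s) / (2 * s) * (bracket ζ ^ (2 * s) * ‖F ζ‖ ^ 2) := by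
    intro ζ
    have hb := bracket_pos ζ
    have hi : ∀ l, Set.indicator {q : ℝ × Plane | q.1 ≤ 8 * bracket q.2}
        (fun q => q.1 ^ (2 * s - 1) * ‖F q.2‖ ^ 2) (l, ζ)
        = Set.indicator (Set.Iic (8 * bracket ζ)) (fun l => l ^ (2 * s - 1) * ‖F ζ‖ ^ 2) l := by
      intro l
      by_cases h : l ≤ 8 * bracket ζ <;> simp [Set.indicator, h]
    simp_rw [hi]
    rw [hμ, setIntegral_indicator measurableSet_Iic]
    calc _ ≤ ∫ l in Set.Ioc 0 (8 * bracket ζ), l ^ (2 * s - 1) * ‖F ζ‖ ^ 2 := by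
          refine setIntegral_mono_set
            ((integrableOn_rpow_Ioc hs (by positivity)).mul_const _) ?_
            (ae_of_all _ fun l hl => ⟨hl.1.1, hl.2⟩)
          filter_upwards [ae_restrict_mem measurableSet_Ioc] with l hl
          exact mul_nonneg (Real.rpow_nonneg hl.1.le _) (sq_nonneg _)
      _ = _ := by
          rw [integral_mul_const, integral_rpow_Ioc hs (by positivity),
            Real.mul_rpow (by norm_num) hb.le]
          ring
  refine h1.trans ?_
  rw [integral_const_mul]
  simp_rw [e2]
  rw [integral_integral_swap i2]
  calc _ ≤ K * Γ * ∫ ζ, 8 ^ (2 * s) / (2 * s) * (bracket ζ ^ (2 * s) * ‖F ζ‖ ^ 2) := by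
        refine mul_le_mul_of_nonneg_left ?_ (by positivity)
        exact integral_mono i2.integral_prod_right (hint.const_mul _) h2
    _ = _ := by rw [integral_const_mul]; ring

/-! ### Sobolev norms and pointwise bounds for `H^∞` functions -/

theorem hsNorm_eq (s : ℝ) (f : L2) :
    hsNorm s f = eLpNorm (fun ζ => ((bracket ζ ^ s : ℝ) : ℂ) * (𝓕 f : L2) ζ) 2 volume := by
  rw [hsNorm]
  congr 1; ext ζ
  rw [bracket, Real.sqrt_eq_rpow, ← Real.rpow_mul (by positivity)]
  congr 4; ring

theorem measurable_bracket_rpow (s : ℝ) : Measurable (fun ζ => bracket ζ ^ s) :=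
  continuous_bracket.measurable.pow_const s

theorem hsNorm_sq_eq (s : ℝ) (f : L2) :
    hsNorm s f ^ 2 = ∫⁻ ζ, ENNReal.ofReal (bracket ζ ^ (2 * s) * ‖(𝓕 f : L2) ζ‖ ^ 2) := by
  have h := eLpNorm_nnreal_pow_eq_lintegral (μ := (volume : Measure Plane)) (p := 2)
    (f := fun ζ => ((bracket ζ ^ s : ℝ) : ℂ) * (𝓕 f : L2) ζ) two_ne_zero
  rw [hsNorm_eq]
  have h2 : ((2 : NNReal) : ℝ) = (2 : ℕ) := by norm_num
  rw [h2, ENNReal.rpow_natCast] at h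
  refine Eq.trans (by simp) (h.trans ?_)
  congr 1; ext ζ
  have hb := bracket_pos ζ
  rw [ENNReal.rpow_natCast, ← ofReal_norm, ← ENNReal.ofReal_pow (norm_nonneg _), norm_mul, mul_pow,
    Complex.norm_real, Real.norm_of_nonneg (by positivity), mul_comm 2 s, Real.rpow_mul hb.le]
  norm_num

theorem integrable_bracket_rpow_neg_four : Integrable (fun ζ : Plane => bracket ζ ^ (-4 : ℝ)) := by
  have h : Integrable (fun ζ : Plane => (1 + ‖ζ‖ ^ 2) ^ (-(4 : ℝ) / 2)) :=
    integrable_rpow_neg_one_add_norm_sq (by simp; norm_num)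
  have h' := h.comp_smul (R := 2 * Real.pi) (by positivity)
  refine h'.congr (ae_of_all _ fun ζ => ?_)
  simp only
  rw [bracket, Real.sqrt_eq_rpow, ← Real.rpow_mul (by positivity)]
  norm_num

namespace MemHInfty

variable {f : L2}

theorem memLp (hf : MemHInfty f) (r : ℝ) :
    MemLp (fun ζ => ((bracket ζ ^ r : ℝ) : ℂ) * (𝓕 f : L2) ζ) 2 := by
  refine ⟨?_, by rw [← hsNorm_eq]; exact hf r⟩
  exact (Complex.measurable_ofReal.comp (measurable_bracket_rpow r)).aestronglyMeasurable.mul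
    (Lp.aestronglyMeasurable _)

theorem integrable_weighted_sq (hf : MemHInfty f) (s : ℝ) :
    Integrable (fun ζ => bracket ζ ^ (2 * s) * ‖(𝓕 f : L2) ζ‖ ^ 2) := by
  have := (memLp_two_iff_integrable_sq_norm (hf.memLp s).1).1 (hf.memLp s)
  refine this.congr (ae_of_all _ fun ζ => ?_)
  have hb := bracket_pos ζ
  simp only
  rw [norm_mul, mul_pow, Complex.norm_real, Real.norm_of_nonneg (by positivity), mul_comm 2 s,
    Real.rpow_mul hb.le]
  norm_num

/-- For integrability, write `⟨ζ⟩^r = ⟨ζ⟩^{-2} ⟨ζ⟩^{r+2}`. The factor `⟨ζ⟩^{-2}` is square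
integrable in the plane, and two more derivatives of `f` are available. -/
theorem integrableL2 (hf : MemHInfty f) (r : ℝ) :
    IntegrableL2 (fun ζ => ((bracket ζ ^ r : ℝ) : ℂ) * (𝓕 f : L2) ζ) := by
  refine ⟨?_, hf.memLp r⟩
  refine ((integrable_bracket_rpow_neg_four.add (hf.integrable_weighted_sq (r + 2))).div_const
    2).mono' (hf.memLp r).1 (ae_of_all _ fun ζ => ?_)
  have hb := bracket_pos ζ
  rw [norm_mul, Complex.norm_real, Real.norm_of_nonneg (by positivity)]
  have e1 : bracket ζ ^ (-4 : ℝ) = (bracket ζ ^ (-2 : ℝ)) ^ 2 := by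
    rw [← Real.rpow_natCast, ← Real.rpow_mul hb.le]; norm_num
  have e2 : bracket ζ ^ (2 * (r + 2)) = (bracket ζ ^ (r + 2)) ^ 2 := by
    rw [← Real.rpow_natCast, ← Real.rpow_mul hb.le]; norm_num; ring_nf
  have e3 : bracket ζ ^ r = bracket ζ ^ (-2 : ℝ) * bracket ζ ^ (r + 2) := by
    rw [← Real.rpow_add hb]; ring_nf
  simp only [Pi.add_apply]
  rw [e1, e2, e3]
  nlinarith [sq_nonneg (bracket ζ ^ (-2 : ℝ) - bracket ζ ^ (r + 2) * ‖(𝓕 f : L2) ζ‖)]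

theorem integrableL2_mul (hf : MemHInfty f) {m : Plane → ℂ} (hm : Measurable m) {C r : ℝ}
    (h : ∀ ζ, ‖m ζ‖ ≤ C * bracket ζ ^ r) : IntegrableL2 (fun ζ => m ζ * (𝓕 f : L2) ζ) := by
  have hb : Measurable (fun ζ : Plane => ((bracket ζ ^ (-r) : ℝ) : ℂ)) :=
    Complex.measurable_ofReal.comp (measurable_bracket_rpow (-r))
  have := (hf.integrableL2 r).bdd_mul (m := fun ζ => m ζ * ((bracket ζ ^ (-r) : ℝ) : ℂ))
    (hm.mul hb).aestronglyMeasurable C fun ζ => by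
      have hb := bracket_pos ζ
      rw [norm_mul, Complex.norm_real, Real.norm_of_nonneg (by positivity), Real.rpow_neg hb.le,
        ← div_eq_mul_inv, div_le_iff₀ (by positivity)]
      exact h ζ
  refine (congrArg IntegrableL2 (funext fun ζ => ?_)).mp this
  have hb := bracket_pos ζ
  have e : ((bracket ζ ^ (-r) : ℝ) : ℂ) * ((bracket ζ ^ r : ℝ) : ℂ) = 1 := by
    rw [← Complex.ofReal_mul, ← Real.rpow_add hb]; simp
  calc _ = m ζ * (((bracket ζ ^ (-r) : ℝ) : ℂ) * ((bracket ζ ^ r : ℝ) : ℂ)) * (𝓕 f : L2) ζ := by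
        ring
    _ = _ := by rw [e, mul_one]

theorem integrableL2_fourier (hf : MemHInfty f) : IntegrableL2 (𝓕 f : L2) := by
  have := hf.integrableL2 0
  simpa using this

theorem integrableL2_freqDeriv (hf : MemHInfty f) (j : Fin 2) :
    IntegrableL2 (freqDeriv j (𝓕 f : L2)) := by
  refine hf.integrableL2_mul (m := fun ζ => Complex.I * ((2 * Real.pi * ζ j : ℝ) : ℂ))
    (C := 1) (r := 1) (by fun_prop) fun ζ => ?_
  rw [norm_mul, Complex.norm_I, one_mul, one_mul, Complex.norm_real, Real.rpow_one]
  exact abs_coord_le_bracket j ζ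

theorem ae_eq_fourierInv (hf : MemHInfty f) : f =ᵐ[volume] 𝓕⁻ ((𝓕 f : L2) : Plane → ℂ) := by
  have := fourierInv_ae_eq (𝓕 f : L2) hf.integrableL2_fourier.1
  rwa [fourierInv_fourier_eq] at this

end MemHInfty

theorem multiplier_ae_eq {m : Plane → ℂ} {f : L2} {H : Plane → ℂ} (hH : IntegrableL2 H)
    (h : ∀ᵐ ζ, m ((2 * Real.pi) • ζ) * (𝓕 f : L2) ζ = H ζ) :
    ((𝓕 (multiplier m f) : L2) =ᵐ[volume] H) ∧ multiplier m f =ᵐ[volume] 𝓕⁻ H := by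
  have hm : MemLp (fun ζ : Plane => m ((2 * Real.pi) • ζ) * (𝓕 f : L2) ζ) 2 volume :=
    (memLp_congr_ae h).2 hH.2
  have h1 : (𝓕 (multiplier m f) : L2) =ᵐ[volume] H := by
    filter_upwards [fourier_multiplier m f hm, h] with ζ a b
    rw [a, b]
  refine ⟨h1, ?_⟩
  have h2 := fourierInv_ae_eq (𝓕 (multiplier m f) : L2) (hH.1.congr h1.symm)
  rw [fourierInv_fourier_eq, fourierInv_congr h1] at h2
  exact h2

namespace MemHInfty

variable {f : L2}

theorem pderiv_ae_eq (hf : MemHInfty f) (j : Fin 2) :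
    ((𝓕 (pderiv j f) : L2) =ᵐ[volume] freqDeriv j (𝓕 f : L2)) ∧
      pderiv j f =ᵐ[volume] 𝓕⁻ (freqDeriv j (𝓕 f : L2)) :=
  multiplier_ae_eq (hf.integrableL2_freqDeriv j) (ae_of_all _ fun ζ => by simp [freqDeriv])

end MemHInfty

/-- A set of full measure is dense. This turns essential suprema into bounds at every point. -/
theorem norm_le_of_ae_le {g : Plane → ℂ} (hg : Continuous g) {C : ℝ}
    (h : ∀ᵐ x, ‖g x‖ ≤ C) (x : Plane) : ‖g x‖ ≤ C := by
  have hd := Measure.dense_of_ae h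
  have hc : IsClosed {x | ‖g x‖ ≤ C} := isClosed_le hg.norm continuous_const
  have h' : x ∈ closure {x | ‖g x‖ ≤ C} := hd x
  rwa [hc.closure_eq] at h'

theorem norm_fourierInv_le_eLpNorm {H : Plane → ℂ} (hH : IntegrableL2 H) {g : L2}
    (hg : g =ᵐ[volume] 𝓕⁻ H) : eLpNorm g ∞ volume < ∞ ∧
      ∀ x, ‖𝓕⁻ H x‖ ≤ (eLpNorm g ∞ volume).toReal := by
  have h1 : eLpNorm g ∞ volume < ∞ := by
    rw [eLpNorm_congr_ae hg]
    refine (eLpNorm_le_of_ae_bound (C := ∫ ζ, ‖H ζ‖) (ae_of_all _ (norm_fourierInv_le H))).trans_lt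
      ?_
    simp
  refine ⟨h1, norm_le_of_ae_le (continuous_fourierInv hH.1) ?_⟩
  have h2 := ae_le_eLpNormEssSup (f := g) (μ := volume)
  filter_upwards [h2, hg] with x a b
  rw [← b, ← toReal_enorm]
  rw [eLpNorm_exponent_top] at h1 ⊢
  exact ENNReal.toReal_mono h1.ne a

theorem gradSupNorm_bound {f : L2} (hf : MemHInfty f) : gradSupNorm f < ∞ ∧
    ∀ x, ‖𝓕⁻ (freqDeriv 0 (𝓕 f : L2)) x‖ + ‖𝓕⁻ (freqDeriv 1 (𝓕 f : L2)) x‖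
      ≤ (gradSupNorm f).toReal := by
  have h0 := norm_fourierInv_le_eLpNorm (hf.integrableL2_freqDeriv 0) (hf.pderiv_ae_eq 0).2
  have h1 := norm_fourierInv_le_eLpNorm (hf.integrableL2_freqDeriv 1) (hf.pderiv_ae_eq 1).2
  refine ⟨ENNReal.add_lt_top.2 ⟨h0.1, h1.1⟩, fun x => ?_⟩
  rw [gradSupNorm, ENNReal.toReal_add h0.1.ne h1.1.ne]
  exact add_le_add (h0.2 x) (h1.2 x)

theorem im_fourierInv_eq_zero {f : L2} (hf : MemHInfty f) (hr : ∀ᵐ p : Plane, (f p).im = 0)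
    (x : Plane) : (𝓕⁻ ((𝓕 f : L2) : Plane → ℂ) x).im = 0 := by
  have hc : Continuous fun x => (𝓕⁻ ((𝓕 f : L2) : Plane → ℂ) x).im :=
    Complex.continuous_im.comp (continuous_fourierInv hf.integrableL2_fourier.1)
  have h : (fun x => (𝓕⁻ ((𝓕 f : L2) : Plane → ℂ) x).im) =ᵐ[volume] fun _ => 0 := by
    filter_upwards [hf.ae_eq_fourierInv, hr] with x a b
    rw [← a, b]
  exact congrFun ((hc.ae_eq_iff_eq volume continuous_const).1 h) x

/-! ### The equation on the Fourier side -/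

theorem measurable_sign : Measurable Real.sign := by
  unfold Real.sign
  exact Measurable.ite measurableSet_Iio measurable_const
    (Measurable.ite measurableSet_Ioi measurable_const measurable_const)

/-- The dispersion relation. -/
def dispersion (α : ℝ) (ζ : Plane) : ℝ :=
  |2 * Real.pi * ζ 0| ^ α * (2 * Real.pi * ζ 0)
    + Real.sign (2 * Real.pi * ζ 0) * (2 * Real.pi * ζ 1) ^ 2

/-- The equation on the Fourier side. -/
theorem fourier_equation {α : ℝ} (hα : 0 < α) {f v : L2} (hf : MemHInfty f)
    (heq : ∀ᵐ p : Plane, v p + fracDx α (pderiv 0 f) p + hilbert (pderiv 1 (pderiv 1 f)) p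
        + f p * pderiv 0 f p = 0) :
    ∀ᵐ ζ, (𝓕 v : L2) ζ = -(Complex.I * (dispersion α ζ : ℂ) * (𝓕 f : L2) ζ)
      - conv (𝓕 f : L2) (freqDeriv 0 (𝓕 f : L2)) ζ := by
  set F : Plane → ℂ := ((𝓕 f : L2) : Plane → ℂ) with hF
  have hcoord : ∀ j : Fin 2, Measurable fun ζ : Plane => 2 * Real.pi * ζ j := fun j => by
    fun_prop
  set H1 : Plane → ℂ := fun ζ => (((|2 * Real.pi * ζ 0| ^ α : ℝ) : ℂ) *
    (Complex.I * ((2 * Real.pi * ζ 0 : ℝ) : ℂ))) * F ζ with hH1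
  set H2 : Plane → ℂ := fun ζ => ((Complex.I * ((2 * Real.pi * ζ 1 : ℝ) : ℂ)) *
    (Complex.I * ((2 * Real.pi * ζ 1 : ℝ) : ℂ))) * F ζ with hH2
  set H3 : Plane → ℂ := fun ζ => (-Complex.I * (Real.sign (2 * Real.pi * ζ 0) : ℂ)) * H2 ζ with hH3
  have i1 : IntegrableL2 H1 := by
    refine hf.integrableL2_mul (C := 1) (r := α + 1) ?_ fun ζ => ?_
    · exact (Complex.measurable_ofReal.comp ((hcoord 0).abs.pow_const α)).mul
        ((Complex.measurable_ofReal.comp (hcoord 0)).const_mul _)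
    · have hb := bracket_pos ζ
      have h0 := abs_coord_le_bracket 0 ζ
      rw [norm_mul, norm_mul, Complex.norm_I, Complex.norm_real, Complex.norm_real,
        Real.norm_of_nonneg (by positivity), Real.rpow_add hb, Real.rpow_one, one_mul, one_mul]
      gcongr
      exact h0
  have i2 : IntegrableL2 H2 := by
    refine hf.integrableL2_mul (C := 1) (r := 2) ?_ fun ζ => ?_
    · exact ((Complex.measurable_ofReal.comp (hcoord 1)).const_mul _).mul
        ((Complex.measurable_ofReal.comp (hcoord 1)).const_mul _)
    · have hb := bracket_pos ζ
      have h0 := abs_coord_le_bracket 1 ζ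
      rw [norm_mul, norm_mul, Complex.norm_I, Complex.norm_real, one_mul, one_mul,
        Real.rpow_two, pow_two]
      gcongr <;> exact h0
  have hsgn : Measurable fun ζ : Plane => -Complex.I * (Real.sign (2 * Real.pi * ζ 0) : ℂ) :=
    (Complex.measurable_ofReal.comp (measurable_sign.comp (hcoord 0))).const_mul _
  have i3 : IntegrableL2 H3 := by
    refine i2.bdd_mul hsgn.aestronglyMeasurable 1 fun ζ => ?_
    rw [norm_mul, norm_neg, Complex.norm_I, one_mul, Complex.norm_real]
    rcases Real.sign_apply_eq (2 * Real.pi * ζ 0) with h | h | h <;> rw [h] <;> norm_num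
  have hp0 := hf.pderiv_ae_eq 0
  have hp1 := hf.pderiv_ae_eq 1
  have a1 : (𝓕 (fracDx α (pderiv 0 f)) : L2) =ᵐ[volume] H1 := by
    refine (multiplier_ae_eq i1 ?_).1
    filter_upwards [hp0.1] with ζ h
    rw [h]
    simp [hH1, freqDeriv, hF]
    ring
  have a2 : (𝓕 (pderiv 1 (pderiv 1 f)) : L2) =ᵐ[volume] H2 := by
    refine (multiplier_ae_eq i2 ?_).1
    filter_upwards [hp1.1] with ζ h
    rw [h]
    simp [hH2, freqDeriv, hF]
    ring
  have a3 : (𝓕 (hilbert (pderiv 1 (pderiv 1 f))) : L2) =ᵐ[volume] H3 := by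
    refine (multiplier_ae_eq i3 ?_).1
    filter_upwards [a2] with ζ h
    rw [h]
    simp [hH3]
  have hconv := hf.integrableL2_fourier.convolution (hf.integrableL2_freqDeriv 0)
  -- The product `u u_x` as an element of `L²`, built from the convolution so that its Fourier
  -- transform is known.
  set N : L2 := 𝓕⁻ (hconv.memLp.toLp _) with hN
  have hNae : N =ᵐ[volume] fun p => f p * pderiv 0 f p := by
    filter_upwards [toLp_fourierInv_ae_eq hconv, hf.ae_eq_fourierInv, hp0.2] with p h1 h2 h3
    rw [hN, h1, fourierInv_conv hf.integrableL2_fourier.1 (hf.integrableL2_freqDeriv 0).1, h2, h3]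
  have hv : v = -fracDx α (pderiv 0 f) - hilbert (pderiv 1 (pderiv 1 f)) - N := by
    apply Lp.ext
    filter_upwards [heq, hNae, Lp.coeFn_sub (-fracDx α (pderiv 0 f)
      - hilbert (pderiv 1 (pderiv 1 f))) N, Lp.coeFn_sub (-fracDx α (pderiv 0 f))
      (hilbert (pderiv 1 (pderiv 1 f))), Lp.coeFn_neg (fracDx α (pderiv 0 f))]
      with p h1 h2 h3 h4 h5
    rw [h3, Pi.sub_apply, h4, Pi.sub_apply, h5, Pi.neg_apply, h2]
    linear_combination h1
  have hFv : (𝓕 v : L2) = -𝓕 (fracDx α (pderiv 0 f)) - 𝓕 (hilbert (pderiv 1 (pderiv 1 f)))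
      - hconv.memLp.toLp _ := by
    have e : (𝓕 N : L2) = hconv.memLp.toLp _ := by rw [hN, fourier_fourierInv_eq]
    rw [← e, hv]
    simp only [sub_eq_add_neg, FourierTransform.fourier_add, FourierTransform.fourier_neg]
  rw [hFv]
  filter_upwards [a1, a3, hconv.memLp.coeFn_toLp, Lp.coeFn_sub (-𝓕 (fracDx α (pderiv 0 f))
      - 𝓕 (hilbert (pderiv 1 (pderiv 1 f)))) (hconv.memLp.toLp _),
      Lp.coeFn_sub (-𝓕 (fracDx α (pderiv 0 f))) (𝓕 (hilbert (pderiv 1 (pderiv 1 f)))),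
      Lp.coeFn_neg (𝓕 (fracDx α (pderiv 0 f)))] with ζ h1 h2 h3 h4 h5 h6
  rw [h4, Pi.sub_apply, h5, Pi.sub_apply, h6, Pi.neg_apply, h1, h2, h3]
  simp only [hH1, hH2, hH3, dispersion]
  push_cast
  linear_combination (Complex.I * (Real.sign (2 * Real.pi * ζ 0) : ℂ)
    * (2 * Real.pi * ζ 1) ^ 2 * F ζ) * Complex.I_sq

/-! ### The truncated energy and its time derivative -/

/-- The truncated energy. -/
def energy (s R : ℝ) (f : L2) : ℝ := ∫ ζ, weight s R ζ * ‖(𝓕 f : L2) ζ‖ ^ 2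

theorem exists_mulCLM {m : Plane → ℂ} (hm : Measurable m) (C : ℝ) (h : ∀ ζ, ‖m ζ‖ ≤ C) :
    ∃ M : L2 →L[ℂ] L2, ∀ F : L2, M F =ᵐ[volume] fun ζ => m ζ * F ζ := by
  have hmem : MemLp m ∞ volume := memLp_top_of_bound hm.aestronglyMeasurable C (ae_of_all _ h)
  refine ⟨(ContinuousLinearMap.mul ℂ ℂ).holderL volume ∞ 2 2 (hmem.toLp m), fun F => ?_⟩
  have h1 := (ContinuousLinearMap.mul ℂ ℂ).coeFn_holder (r := 2) (hmem.toLp m) F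
  filter_upwards [h1, hmem.coeFn_toLp] with ζ a b
  refine a.trans ?_
  rw [b]
  rfl

/-- The energy is the quadratic form of a bounded symmetric operator `M` applied to the Fourier
transform, so differentiability in `L²` is enough. Symmetry merges the two terms of the product rule
into twice a real part. -/
theorem hasDerivWithinAt_energy {s : ℝ} (hs : 0 < s) {R : ℝ} (hR : 0 ≤ R) {u : ℝ → L2} {v : L2}
    {S : Set ℝ} {t : ℝ} (hu : HasDerivWithinAt u v S t) :
    HasDerivWithinAt (fun t => energy s R (u t))
      (2 * (∫ ζ, inner ℂ ((weight s R ζ : ℂ) * (𝓕 (u t) : L2) ζ) ((𝓕 v : L2) ζ)).re) S t := by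
  obtain ⟨M, hM⟩ := exists_mulCLM (m := fun ζ => (weight s R ζ : ℂ))
    (Complex.measurable_ofReal.comp (measurable_weight s R)) (R ^ (2 * s) / (2 * s)) (fun ζ => by
      rw [Complex.norm_real, Real.norm_of_nonneg (weight_nonneg s R ζ)]
      exact weight_le_const hs hR ζ)
  have hF : HasDerivWithinAt (fun t => (𝓕 (u t) : L2)) (𝓕 v : L2) S t :=
    ((fourierCLM ℂ L2 (F := L2)).restrictScalars ℝ).hasFDerivAt.comp_hasDerivWithinAt t hu
  have hMF : HasDerivWithinAt (fun t => M (𝓕 (u t) : L2)) (M (𝓕 v : L2)) S t :=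
    (M.restrictScalars ℝ).hasFDerivAt.comp_hasDerivWithinAt t hF
  have hI := hMF.inner ℂ hF
  have hre := Complex.reCLM.hasFDerivAt.comp_hasDerivWithinAt t hI
  have key : ∀ F G : L2, inner ℂ (M F) G = ∫ ζ, inner ℂ ((weight s R ζ : ℂ) * F ζ) (G ζ) := by
    intro F G
    rw [L2.inner_def]
    refine integral_congr_ae ?_
    filter_upwards [hM F] with ζ h
    rw [h]
  have hconj : ∀ F G : L2, inner ℂ (M F) G = (starRingEnd ℂ) (inner ℂ (M G) F) := by
    intro F G
    rw [key, key, ← integral_conj]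
    congr 1; ext ζ
    simp only [RCLike.inner_apply, map_mul, Complex.conj_ofReal, Complex.conj_conj]
    ring
  have hE : ∀ f : L2, energy s R f = (inner ℂ (M (𝓕 f : L2)) (𝓕 f : L2)).re := by
    intro f
    rw [key, energy, ← Complex.ofReal_re (∫ ζ, weight s R ζ * ‖(𝓕 f : L2) ζ‖ ^ 2),
      ← integral_complex_ofReal]
    congr 2; ext ζ
    simp only [RCLike.inner_apply, map_mul, Complex.conj_ofReal]
    rw [mul_left_comm, Complex.mul_conj, Complex.normSq_eq_norm_sq]
    push_cast; ring
  simp_rw [hE]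
  refine hre.congr_deriv ?_
  rw [hconj (𝓕 v : L2) (𝓕 (u t) : L2), ← key]
  simp only [Complex.reCLM_apply, Complex.add_re, Complex.conj_re]
  ring

/-- The dispersive contribution is `i` times a real number at each frequency, and has zero real
part. -/
theorem re_integral_inner_fourier_eq {s : ℝ} (hs : 0 < s) {R : ℝ} (hR : 0 ≤ R) {α : ℝ}
    (hα : 0 < α) {f v : L2} (hf : MemHInfty f)
    (heq : ∀ᵐ p : Plane, v p + fracDx α (pderiv 0 f) p + hilbert (pderiv 1 (pderiv 1 f)) p
        + f p * pderiv 0 f p = 0) :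
    (∫ ζ, inner ℂ ((weight s R ζ : ℂ) * (𝓕 f : L2) ζ) ((𝓕 v : L2) ζ)).re
      = -(∫ ζ, inner ℂ ((weight s R ζ : ℂ) * (𝓕 f : L2) ζ)
          (conv (𝓕 f : L2) (freqDeriv 0 (𝓕 f : L2)) ζ)).re := by
  set F : Plane → ℂ := ((𝓕 f : L2) : Plane → ℂ) with hF
  have hFi : IntegrableL2 F := hf.integrableL2_fourier
  have hc := hFi.convolution (hf.integrableL2_freqDeriv 0)
  have hwF : IntegrableL2 (fun ζ => (weight s R ζ : ℂ) * F ζ) :=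
    hFi.bdd_mul (Complex.measurable_ofReal.comp (measurable_weight s R)).aestronglyMeasurable
      (R ^ (2 * s) / (2 * s)) fun ζ => by
        rw [Complex.norm_real, Real.norm_of_nonneg (weight_nonneg s R ζ)]
        exact weight_le_const hs hR ζ
  have i1 : Integrable (fun ζ => inner ℂ ((weight s R ζ : ℂ) * F ζ) ((𝓕 v : L2) ζ)) := by
    refine (L2.integrable_inner (𝕜 := ℂ) (hwF.memLp.toLp _) (𝓕 v : L2)).congr ?_
    filter_upwards [hwF.memLp.coeFn_toLp] with ζ h
    rw [h]
  have e1 : (∫ ζ, inner ℂ ((weight s R ζ : ℂ) * F ζ) ((𝓕 v : L2) ζ)).re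
      = ∫ ζ, (inner ℂ ((weight s R ζ : ℂ) * F ζ) ((𝓕 v : L2) ζ)).re := (integral_re i1).symm
  have e2 : (∫ ζ, inner ℂ ((weight s R ζ : ℂ) * F ζ) (conv F (freqDeriv 0 F) ζ)).re
      = ∫ ζ, (inner ℂ ((weight s R ζ : ℂ) * F ζ) (conv F (freqDeriv 0 F) ζ)).re :=
    (integral_re (hwF.inner_integrable hc)).symm
  rw [e1, e2, ← integral_neg]
  refine integral_congr_ae ?_
  filter_upwards [fourier_equation hα hf heq] with ζ h
  rw [h, inner_sub_right, inner_neg_right]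
  have e3 : inner ℂ ((weight s R ζ : ℂ) * F ζ) (Complex.I * (dispersion α ζ : ℂ) * F ζ)
      = Complex.I * ((weight s R ζ * dispersion α ζ * ‖F ζ‖ ^ 2 : ℝ) : ℂ) := by
    simp only [RCLike.inner_apply, map_mul, Complex.conj_ofReal]
    have := Complex.mul_conj (F ζ)
    rw [Complex.normSq_eq_norm_sq] at this
    push_cast at this ⊢
    linear_combination Complex.I * (dispersion α ζ : ℂ) * (weight s R ζ : ℂ) * this
  rw [e3, Complex.sub_re, Complex.neg_re, Complex.I_mul_re, Complex.ofReal_im]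
  ring

/-- The energy inequality in differential form. -/
theorem exists_energy_deriv_bound {s : ℝ} (hs : 0 < s) : ∃ K : ℝ, 0 < K ∧
    ∀ (α : ℝ), 0 < α → ∀ (T : ℝ) (u₀ : L2) (u : ℝ → L2),
      (∀ t ∈ Set.Icc 0 T, MemHInfty (u t)) → IsRealOn T u → IsSolution α T u₀ u →
      ∀ (R : ℝ), 0 < R → ∀ t ∈ Set.Icc 0 T, ∃ d : ℝ,
        HasDerivWithinAt (fun t => energy s R (u t)) d (Set.Icc 0 T) t ∧
        ENNReal.ofReal |d| ≤ ENNReal.ofReal K * gradSupNorm (u t) * hsNorm s (u t) ^ 2 := by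
  obtain ⟨K, hK, hbound⟩ := exists_weighted_bound hs
  refine ⟨2 * K, by positivity, fun α hα T u₀ u hu hreal hsol R hR t ht => ?_⟩
  obtain ⟨v, hv, heq⟩ := hsol.2 t ht
  refine ⟨_, hasDerivWithinAt_energy hs hR.le hv, ?_⟩
  have hf := hu t ht
  have hΓ := gradSupNorm_bound hf
  have h := hbound R hR _ hf.integrableL2_fourier (hf.integrableL2_freqDeriv 0)
    (hf.integrableL2_freqDeriv 1) (im_fourierInv_eq_zero hf (hreal t ht))
    (hf.integrable_weighted_sq s) _ hΓ.2
  rw [re_integral_inner_fourier_eq hs hR.le hα hf heq, mul_neg, abs_neg, abs_mul, abs_two]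
  have hsq : hsNorm s (u t) ^ 2
      = ENNReal.ofReal (∫ ζ, bracket ζ ^ (2 * s) * ‖(𝓕 (u t) : L2) ζ‖ ^ 2) := by
    rw [hsNorm_sq_eq, ofReal_integral_eq_lintegral_ofReal (hf.integrable_weighted_sq s)]
    exact ae_of_all _ fun ζ =>
      mul_nonneg (Real.rpow_nonneg (bracket_pos ζ).le _) (sq_nonneg _)
  rw [hsq, ← ENNReal.ofReal_toReal hΓ.1.ne, ← ENNReal.ofReal_mul (by positivity),
    ← ENNReal.ofReal_mul (by positivity)]
  apply ENNReal.ofReal_le_ofReal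
  linarith

/-! ### Removing the truncation and integrating in time -/

theorem ofReal_energy_le {s : ℝ} (hs : 0 < s) (R : ℝ) {f : L2} (hf : MemHInfty f) :
    ENNReal.ofReal (energy s R f) ≤ ENNReal.ofReal (weightConst s) * hsNorm s f ^ 2 := by
  have h : energy s R f
      ≤ ∫ ζ, weightConst s * (bracket ζ ^ (2 * s) * ‖(𝓕 f : L2) ζ‖ ^ 2) := by
    refine integral_mono_of_nonneg (ae_of_all _ fun ζ =>
      mul_nonneg (weight_nonneg s R ζ) (sq_nonneg _))
      ((hf.integrable_weighted_sq s).const_mul _) (ae_of_all _ fun ζ => ?_)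
    simp only
    rw [← mul_assoc]
    gcongr
    exact weight_le hs R ζ
  rw [hsNorm_sq_eq, ← ofReal_integral_eq_lintegral_ofReal (hf.integrable_weighted_sq s)
    (ae_of_all _ fun ζ => mul_nonneg (Real.rpow_nonneg (bracket_pos ζ).le _) (sq_nonneg _)),
    ← ENNReal.ofReal_mul (weightConst_pos hs).le, ← integral_const_mul]
  exact ENNReal.ofReal_le_ofReal h

/-- Fatou's lemma along `R = n + 1`: at each frequency the truncated weight is eventually equal to
the full one. -/
theorem hsNorm_sq_le_of_energy_le {s : ℝ} (hs : 0 < s) {f : L2} (hf : MemHInfty f) {B : ℝ≥0∞}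
    (h : ∀ n : ℕ, ENNReal.ofReal (energy s (n + 1) f) ≤ B) :
    ENNReal.ofReal (weightConst s) * hsNorm s f ^ 2 ≤ B := by
  rw [hsNorm_sq_eq, ← lintegral_const_mul' _ _ ENNReal.ofReal_ne_top]
  have hint : ∀ n : ℕ, ENNReal.ofReal (energy s (n + 1) f)
      = ∫⁻ ζ, ENNReal.ofReal (weight s (n + 1) ζ * ‖(𝓕 f : L2) ζ‖ ^ 2) := fun n => by
    refine ofReal_integral_eq_lintegral_ofReal ?_ (ae_of_all _ fun ζ =>
      mul_nonneg (weight_nonneg _ _ ζ) (sq_nonneg _))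
    refine ((hf.integrable_weighted_sq s).const_mul (weightConst s)).mono'
      ((measurable_weight s _).aestronglyMeasurable.mul
        ((Lp.aestronglyMeasurable (𝓕 f : L2)).norm.pow 2)) (ae_of_all _ fun ζ => ?_)
    rw [Real.norm_of_nonneg (mul_nonneg (weight_nonneg _ _ ζ) (sq_nonneg _)), ← mul_assoc]
    gcongr
    exact weight_le hs _ ζ
  have hpt : ∀ ζ, ENNReal.ofReal (weightConst s) *
      ENNReal.ofReal (bracket ζ ^ (2 * s) * ‖(𝓕 f : L2) ζ‖ ^ 2)
      ≤ liminf (fun n : ℕ => ENNReal.ofReal (weight s (n + 1) ζ * ‖(𝓕 f : L2) ζ‖ ^ 2)) atTop := by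
    intro ζ
    refine le_liminf_of_le (by isBoundedDefault) ?_
    obtain ⟨N, hN⟩ := exists_nat_ge (bracket ζ)
    filter_upwards [eventually_ge_atTop N] with n hn
    have : (N : ℝ) ≤ n := by exact_mod_cast hn
    rw [weight_eq (by linarith), ← ENNReal.ofReal_mul (weightConst_pos hs).le, mul_assoc]
  calc _ ≤ ∫⁻ ζ, liminf (fun n : ℕ =>
        ENNReal.ofReal (weight s (n + 1) ζ * ‖(𝓕 f : L2) ζ‖ ^ 2)) atTop := lintegral_mono hpt
    _ ≤ liminf (fun n : ℕ => ∫⁻ ζ,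
        ENNReal.ofReal (weight s (n + 1) ζ * ‖(𝓕 f : L2) ζ‖ ^ 2)) atTop := by
        refine lintegral_liminf_le' fun n => ?_
        exact ((measurable_weight s _).aemeasurable.mul
          ((Lp.aestronglyMeasurable (𝓕 f : L2)).norm.aemeasurable.pow_const 2)).ennreal_ofReal
    _ ≤ B := by
        simp_rw [← hint]
        exact liminf_le_of_le (by isBoundedDefault) fun b hb => by
          obtain ⟨n, hn⟩ := hb.exists
          exact hn.trans (h n)

theorem hsNorm_add_le (s : ℝ) (f g : L2) : hsNorm s (f + g) ≤ hsNorm s f + hsNorm s g := by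
  rw [hsNorm_eq, hsNorm_eq, hsNorm_eq]
  have hm : ∀ f : L2, AEStronglyMeasurable
      (fun ζ => ((bracket ζ ^ s : ℝ) : ℂ) * (𝓕 f : L2) ζ) volume := fun f =>
    (Complex.measurable_ofReal.comp (measurable_bracket_rpow s)).aestronglyMeasurable.mul
      (Lp.aestronglyMeasurable _)
  refine le_trans (le_of_eq (eLpNorm_congr_ae ?_)) (eLpNorm_add_le (hm f) (hm g) (by norm_num))
  rw [FourierTransform.fourier_add]
  filter_upwards [Lp.coeFn_add (𝓕 f : L2) (𝓕 g : L2)] with ζ h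
  rw [h]
  simp only [Pi.add_apply]
  ring

/-- Continuity gives local bounds, and `[0,T]` is compact. -/
theorem ContinuousInHInfty.exists_bound {T : ℝ} {u : ℝ → L2} (hu : ContinuousInHInfty T u)
    (s : ℝ) : ∃ B : ℝ≥0∞, B < ∞ ∧ ∀ t ∈ Set.Icc 0 T, hsNorm s (u t) ≤ B := by
  refine (isCompact_Icc (a := (0 : ℝ)) (b := T)).induction_on
    (p := fun S => ∃ B : ℝ≥0∞, B < ∞ ∧ ∀ t ∈ S, hsNorm s (u t) ≤ B) ?_ ?_ ?_ ?_
  · exact ⟨0, by simp, by simp⟩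
  · rintro S S' hS ⟨B, hB, h⟩
    exact ⟨B, hB, fun t ht => h t (hS ht)⟩
  · rintro S S' ⟨B, hB, h⟩ ⟨B', hB', h'⟩
    refine ⟨max B B', max_lt hB hB', fun t ht => ?_⟩
    rcases ht with ht | ht
    · exact (h t ht).trans (le_max_left _ _)
    · exact (h' t ht).trans (le_max_right _ _)
  · intro t₀ ht₀
    have hev := (hu.2 s t₀ ht₀).eventually (gt_mem_nhds (zero_lt_one (α := ℝ≥0∞)))
    refine ⟨_, hev, 1 + hsNorm s (u t₀), ENNReal.add_lt_top.2 ⟨by simp, hu.1 t₀ ht₀ s⟩,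
      fun t ht => ?_⟩
    have h := hsNorm_add_le s (u t - u t₀) (u t₀)
    rw [sub_add_cancel] at h
    refine h.trans ?_
    gcongr
    exact le_of_lt ht

/-- The finite integral of `g` makes `deriv E` integrable, so the fundamental theorem of calculus
applies. Measurability is needed for `deriv E` only, where it is automatic; `g` may be any function.
-/
theorem energy_le_add_lintegral {T : ℝ} {E : ℝ → ℝ} {g : ℝ → ℝ≥0∞}
    (hE : ∀ t ∈ Set.Icc 0 T, ∃ d : ℝ, HasDerivWithinAt E d (Set.Icc 0 T) t ∧
      ENNReal.ofReal |d| ≤ g t) (hg : ∫⁻ t in Set.Icc 0 T, g t < ∞) {t : ℝ}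
    (ht : t ∈ Set.Icc 0 T) :
    ENNReal.ofReal (E t) ≤ ENNReal.ofReal (E 0) + ∫⁻ t in Set.Icc 0 T, g t := by
  have hd : ∀ x ∈ Set.Ioo 0 t, HasDerivAt E (deriv E x) x ∧
      ENNReal.ofReal |deriv E x| ≤ g x := by
    intro x hx
    obtain ⟨d, h1, h2⟩ := hE x ⟨hx.1.le, hx.2.le.trans ht.2⟩
    have h3 := h1.hasDerivAt (Icc_mem_nhds hx.1 (hx.2.trans_le ht.2))
    rw [h3.deriv]
    exact ⟨h3, h2⟩
  have hbound : ∫⁻ x in Set.Ioc 0 t, ENNReal.ofReal |deriv E x|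
      ≤ ∫⁻ t in Set.Icc 0 T, g t := by
    rw [← restrict_Ioo_eq_restrict_Ioc]
    calc _ ≤ ∫⁻ x in Set.Ioo 0 t, g x := by
          refine lintegral_mono_ae ?_
          filter_upwards [ae_restrict_mem measurableSet_Ioo] with x hx
          exact (hd x hx).2
      _ ≤ _ := lintegral_mono_set
        (Set.Ioo_subset_Icc_self.trans (Set.Icc_subset_Icc_right ht.2))
  have hint : IntegrableOn (deriv E) (Set.Ioc 0 t) := by
    refine ⟨(measurable_deriv E).aestronglyMeasurable, ?_⟩
    rw [hasFiniteIntegral_iff_norm]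
    exact hbound.trans_lt hg
  have hcont : ContinuousOn E (Set.Icc 0 t) := fun x hx => by
    obtain ⟨d, h1, -⟩ := hE x ⟨hx.1, hx.2.trans ht.2⟩
    exact h1.continuousWithinAt.mono (Set.Icc_subset_Icc_right ht.2)
  have hftc := intervalIntegral.integral_eq_sub_of_hasDerivAt_of_le ht.1 hcont
    (fun x hx => (hd x hx).1) ((intervalIntegrable_iff_integrableOn_Ioc_of_le ht.1).2 hint)
  rw [intervalIntegral.integral_of_le ht.1] at hftc
  have h1 : E t = E 0 + ∫ x in Set.Ioc 0 t, deriv E x := by rw [hftc]; ring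
  rw [h1]
  refine ENNReal.ofReal_add_le.trans ?_
  gcongr
  refine le_trans (ENNReal.ofReal_le_ofReal (le_abs_self _)) ?_
  rw [← Real.norm_eq_abs, ofReal_norm]
  refine (enorm_integral_le_lintegral_enorm _).trans (le_trans (le_of_eq ?_) hbound)
  simp_rw [← Real.norm_eq_abs, ofReal_norm]

end

end FracBO


/-! ### The energy estimate -/

open FracBO MeasureTheory
open scoped ENNReal

theorem lemma4p1 (s : ℝ) (hs : 0 < s) :
    ∃ C₀ : ℝ, 0 < C₀ ∧
      ∀ (α : ℝ), 0 < α → α ≤ 1 → ∀ (T : ℝ), 0 < T →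
      ∀ (u₀ : FracBO.L2) (u : ℝ → FracBO.L2),
        FracBO.ContinuousInHInfty T u → FracBO.IsRealOn T u → FracBO.IsSolution α T u₀ u →
        FracBO.normLinftyHs T s u ^ 2 ≤
          FracBO.hsNorm s u₀ ^ 2 +
            ENNReal.ofReal C₀ * FracBO.normGradL1Linfty T u * FracBO.normLinftyHs T s u ^ 2 := by
  obtain ⟨K, hK, hbound⟩ := exists_energy_deriv_bound hs
  have hc := weightConst_pos hs
  refine ⟨K / weightConst s, by positivity, fun α hα _ T hT u₀ u hcont hreal hsol => ?_⟩
  set M := normLinftyHs T s u with hM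
  set N := normGradL1Linfty T u with hN
  obtain ⟨B, hB, hle⟩ := hcont.exists_bound s
  have hMB : M ≤ B := by
    refine essSup_le_of_ae_le _ ?_
    filter_upwards [ae_restrict_mem measurableSet_Icc] with t ht
    exact hle t ht
  have hMtop : M < ∞ := hMB.trans_lt hB
  -- This case goes first because `∞ * 0 = 0` in `ℝ≥0∞`: an infinite `N` makes the right-hand side
  -- infinite only if `M ≠ 0`.
  by_cases hM0 : M = 0
  · rw [hM0]; simp
  by_cases hNtop : N = ∞
  · rw [hNtop, ENNReal.mul_top (by simpa using div_pos hK hc), ENNReal.top_mul (by simpa using hM0)]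
    simp
  have hae : ∀ᵐ t ∂(volume.restrict (Set.Icc 0 T)), hsNorm s (u t) ≤ M := ae_le_essSup
  set g : ℝ → ℝ≥0∞ := fun t => ENNReal.ofReal K * gradSupNorm (u t) * hsNorm s (u t) ^ 2 with hg
  have hgint : ∫⁻ t in Set.Icc 0 T, g t ≤ ENNReal.ofReal K * N * M ^ 2 := by
    calc _ ≤ ∫⁻ t in Set.Icc 0 T, (ENNReal.ofReal K * M ^ 2) * gradSupNorm (u t) := by
          refine lintegral_mono_ae ?_
          filter_upwards [hae] with t ht
          calc g t ≤ ENNReal.ofReal K * gradSupNorm (u t) * M ^ 2 := by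
                simp only [hg]; gcongr
            _ = _ := by ring
      _ = ENNReal.ofReal K * M ^ 2 * N := by
          rw [lintegral_const_mul' _ _ (ENNReal.mul_ne_top ENNReal.ofReal_ne_top
            (ENNReal.pow_ne_top hMtop.ne))]
          rfl
      _ = _ := by ring
  have hglt : ∫⁻ t in Set.Icc 0 T, g t < ∞ :=
    hgint.trans_lt (ENNReal.mul_lt_top (ENNReal.mul_lt_top ENNReal.ofReal_lt_top
      (lt_top_iff_ne_top.2 hNtop)) (ENNReal.pow_lt_top hMtop))
  have h0 : (0 : ℝ) ∈ Set.Icc 0 T := ⟨le_rfl, hT.le⟩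
  have hpt : ∀ t ∈ Set.Icc 0 T, ENNReal.ofReal (weightConst s) * hsNorm s (u t) ^ 2
      ≤ ENNReal.ofReal (weightConst s) * hsNorm s u₀ ^ 2 + ENNReal.ofReal K * N * M ^ 2 := by
    intro t ht
    refine hsNorm_sq_le_of_energy_le hs (hcont.1 t ht) fun n => ?_
    have h1 := energy_le_add_lintegral
      (hbound α hα T u₀ u hcont.1 hreal hsol (n + 1) (by positivity)) hglt ht
    refine h1.trans (add_le_add ?_ hgint)
    rw [← hsol.1]
    exact ofReal_energy_le hs _ (hcont.1 0 h0)
  have hc0 : ENNReal.ofReal (weightConst s) ≠ 0 := by simpa using hc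
  have hKc : ENNReal.ofReal K
      = ENNReal.ofReal (weightConst s) * ENNReal.ofReal (K / weightConst s) := by
    rw [← ENNReal.ofReal_mul hc.le, mul_div_cancel₀ _ hc.ne']
  have hpt' : ∀ t ∈ Set.Icc 0 T, hsNorm s (u t) ^ 2
      ≤ hsNorm s u₀ ^ 2 + ENNReal.ofReal (K / weightConst s) * N * M ^ 2 := by
    intro t ht
    have h := hpt t ht
    rw [hKc, mul_assoc, mul_assoc, ← mul_add, ← mul_assoc] at h
    exact (ENNReal.mul_le_mul_iff_right hc0 ENNReal.ofReal_ne_top).1 h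
  -- The essential supremum is of the norm and not of its square, so the pointwise bound passes
  -- through a square root.
  have hsqrt : M ≤ (hsNorm s u₀ ^ 2
      + ENNReal.ofReal (K / weightConst s) * N * M ^ 2) ^ (2 : ℝ)⁻¹ := by
    refine essSup_le_of_ae_le _ ?_
    filter_upwards [ae_restrict_mem measurableSet_Icc] with t ht
    rw [ENNReal.le_rpow_inv_iff two_pos, ENNReal.rpow_two]
    exact hpt' t ht
  calc M ^ 2 ≤ ((hsNorm s u₀ ^ 2
      + ENNReal.ofReal (K / weightConst s) * N * M ^ 2) ^ (2 : ℝ)⁻¹) ^ 2 := by gcongr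
    _ = _ := by
      rw [← ENNReal.rpow_natCast, ← ENNReal.rpow_mul]
      norm_num
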